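/- All rings are commutative. Let $R$ be a Dedekind domain with fraction field $K=Q(R)$. An \emph{order} over $R$ is an $R$-algebra $A$ that is finitely generated and torsion-free as an $R$-module and whose total quotient ring $Q(A)=A\otimes_R K$ is a finite étale $K$-algebra (that is, finite-dimensional with non-degenerate trace form $(x,y)\mapsto \mathrm{Tr}_{Q(A)/K}(xy)$). Write $A^{\dagger}=\{x\in Q(A): \mathrm{Tr}_{Q(A)/K}(xA)\subseteq R\}$ for the trace dual of $A$ and $\overline{A}$ for the integral closure of $A$ in $Q(A)$; one has $A\subseteq\overline{A}\subseteq A^{\dagger}$ (this is included in the conclusions below). \textbf{(1) Local statement.} Let $R$ be a discrete valuation ring with maximal ideal $\mathfrak{p}$ and $\mathrm{char}(R/\mathfrak{p})\neq 2$, let $A$ be an order over $R$, and let $B=A^{\dagger}/A$. Suppose that $B$ is cyclic as an $R$-module, or that $B$ is generated by two elements as an $R$-module and $\mathrm{length}_R(B)$ is odd. Then $$\overline{A}/A=\mathrm{lr}(B):=\sum_{k\ge 0}\bigl(\mathfrak{p}^kB\cap B[\mathfrak{p}^k]\bigr),\qquad B[\mathfrak{p}^k]=\{b\in B:\mathfrak{p}^kb=0\}.$$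 \textbf{(2) Global statement.} Let $A$ be an order over $\mathbb{Z}$ and let $B=A^{\dagger}/A$. Suppose that $B$ is finite, that $\#B$ is odd, and that $B\cong\mathbb{Z}/m\mathbb{Z}\times\mathbb{Z}/m'\mathbb{Z}$ with positive integers $m=\prod_p p^{n(p)}$ and $m'=\prod_p p^{n'(p)}$ such that for every prime $p$ one has $n(p)n'(p)=0$ or $n(p)+n'(p)$ is odd. Then $$\overline{A}/A=\mathrm{lr}(B):=\sum_{r\in\mathbb{Z}}\bigl(rB\cap B[r]\bigr),\qquad B[r]=\{b\in B: rb=0\}.$$ \textbf{(3)} In particular, if $\alpha$ is an algebraic integer, $K=\mathbb{Q}(\alpha)$, $A=\mathbb{Z}[\alpha]$, $A^{\dagger}=\{x\in K:\mathrm{Tr}_{K/\mathbb{Q}}(xA)\subseteq\mathbb{Z}\}$, $\overline{A}=\mathcal{O}_K$, and $B=A^{\dagger}/A$ satisfies the conditions in (2), then $\overline{A}/A=\mathrm{lr}(B)$. -/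

import Mathlib

/-- A finite étale algebra `Q` over a field `K`: finite-dimensional, and the trace form
`(x, y) ↦ Tr_{Q/K}(xy)` is non-degenerate. -/
def IsFiniteEtaleAlgebra (K Q : Type*) [Field K] [CommRing Q] [Algebra K Q] : Prop :=
  Module.Finite K Q ∧ (Algebra.traceForm K Q).Nondegenerate

/-- `A` is an order over the Dedekind domain `R`. Here `K` is the fraction field of `R` and `Q` is
the total quotient ring of `A` (the localization of `A` at all its non-zero-divisors), regarded as a
`K`-algebra compatibly with the map `R → A`. -/
structure IsOrderOver (R A K Q : Type*) [CommRing R] [IsDedekindDomain R] [CommRing A] [Algebra R A]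
    [Field K] [Algebra R K] [IsFractionRing R K]
    [CommRing Q] [Algebra A Q] [IsFractionRing A Q] [Algebra K Q] : Prop where
  finite : Module.Finite R A
  torsionFree : Module.IsTorsionFree R A
  etale : IsFiniteEtaleAlgebra K Q

section Order

variable (R A K Q : Type*) [CommRing R] [CommRing A] [Algebra R A] [Field K] [Algebra R K]
  [CommRing Q] [Algebra A Q] [Algebra K Q] [Algebra R Q] [IsScalarTower R A Q] [IsScalarTower R K Q]

/-- The image of `A` in `Q`, as an `R`-submodule. -/
def orderSubmodule : Submodule R Q :=
  LinearMap.range (IsScalarTower.toAlgHom R A Q).toLinearMap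

/-- The trace dual `M† = {x ∈ Q | Tr_{Q/K}(xM) ⊆ R}` of an `R`-submodule `M` of `Q`. -/
noncomputable def traceDualSubmodule (M : Submodule R Q) : Submodule R Q where
  carrier := {x | ∀ y ∈ M, Algebra.trace K Q (x * y) ∈ (algebraMap R K).range}
  zero_mem' := fun y _ => by simp
  add_mem' := fun {a b} ha hb y hy => by
    rw [add_mul, map_add]
    exact add_mem (ha y hy) (hb y hy)
  smul_mem' := fun r x hx y hy => by
    rw [smul_mul_assoc, ← mul_smul_comm]
    exact hx _ (M.smul_mem r hy)

/-- The trace dual `A†` of `A`. -/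
noncomputable def orderDual : Submodule R Q := traceDualSubmodule R K Q (orderSubmodule R A Q)

/-- The integral closure `Ā` of `A` in `Q`, as an `R`-submodule. -/
noncomputable def orderClosure : Submodule R Q :=
  Subalgebra.toSubmodule ((integralClosure A Q).restrictScalars R)

/-- The `R`-module `A†/A`. -/
abbrev DualQuotient : Type _ :=
  (orderDual R A K Q) ⧸ (orderSubmodule R A Q).submoduleOf (orderDual R A K Q)

/-- For `M` with `A ⊆ M ⊆ A†`, the submodule `M/A` of `A†/A`. -/
noncomputable def quotientSubmodule (M : Submodule R Q) : Submodule R (DualQuotient R A K Q) :=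
  (M.submoduleOf (orderDual R A K Q)).map
    ((orderSubmodule R A Q).submoduleOf (orderDual R A K Q)).mkQ

/-- `A ⊆ Ā ⊆ A†`, and `Ā/A` is the given submodule `L` of `A†/A`. -/
def ClosureQuotientEq (L : Submodule R (DualQuotient R A K Q)) : Prop :=
  orderSubmodule R A Q ≤ orderClosure R A Q ∧
  orderClosure R A Q ≤ orderDual R A K Q ∧
  quotientSubmodule R A K Q (orderClosure R A Q) = L

end Order

/-- The lower root `∑_k (𝔪^k M ∩ M[𝔪^k])` of a module `M` over a local ring with maximal ideal `𝔪`.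
If `𝔪^n M = 0` then the terms with `k > n` are zero, so the sum over all `k` is the sum over
`0 ≤ k ≤ n`. -/
noncomputable def lowerRoot (R M : Type*) [CommRing R] [IsLocalRing R] [AddCommGroup M]
    [Module R M] : Submodule R M :=
  ⨆ k : ℕ, (IsLocalRing.maximalIdeal R ^ k • (⊤ : Submodule R M)) ⊓
    Submodule.torsionBySet R M ((IsLocalRing.maximalIdeal R ^ k : Ideal R) : Set R)

/-- The lower root `∑_{r ∈ ℤ} (rB ∩ B[r])` of an abelian group `B`. -/
noncomputable def lowerRootInt (B : Type*) [AddCommGroup B] [Module ℤ B] : Submodule ℤ B :=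
  ⨆ r : ℤ, LinearMap.range (LinearMap.lsmul ℤ B r) ⊓ Submodule.torsionBy ℤ B r

/-- `B ≅ ℤ/m × ℤ/m'` has odd order, where `m = ∏ p^{n(p)}` and `m' = ∏ p^{n'(p)}` are positive
integers such that for all primes `p` one has `n(p)n'(p) = 0` or `n(p) + n'(p)` is odd. -/
def IsOddAlternating (B : Type*) [AddCommGroup B] : Prop :=
  Odd (Nat.card B) ∧ ∃ m m' : ℕ, 0 < m ∧ 0 < m' ∧ Nonempty (B ≃+ ZMod m × ZMod m') ∧
    ∀ p : ℕ, p.Prime → m.factorization p * m'.factorization p = 0 ∨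
      Odd (m.factorization p + m'.factorization p)

/-!
Over a discrete valuation ring with uniformizer `ϖ`, let `O` be the integral closure of `A`, write
`M†` for the trace dual of a lattice `M`, and let `L` be the preimage of `lr(A† / A)` in `A†`.

* As `2` is a unit and `A† / A` has at most two generators, it splits into orthogonal cyclic
  summands. Under the length hypothesis this puts into `L` every `v ∈ A†` with `Tr(v ^ 2) ∈ R`, so
  that `A ⊆ O ⊆ L ⊆ L† ⊆ O† ⊆ A†`.
* The ideal `ϖO† ∩ O` has traces in the maximal ideal, and its image in `O / ϖO` has dimension at
  most two. In residue characteristic different from two, an ideal of dimension at most two whose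
  elements have trace zero contains no nonzero idempotent, so it is nil. Hence `ϖO† ∩ O` lies in
  `J = √(ϖO)`. If `z ∈ ϖO†` and `J ^ (n + 1) z ⊆ O`, then every element of `J ^ n z` multiplies `J`
  into itself and is therefore integral; descending on `n` gives `ϖO† ⊆ O`.
* So `O† / O` is a vector space over the residue field, of dimension at most one in the cyclic case
  and at most two otherwise. In the second case the length is odd, so `L ≠ L†`, and in both cases
  there is no room for `O ≠ L`, which would also make `L† ≠ O†`.

Over the integers everything commutes with localization at a prime, and at the primes dividing
`mm'` the local argument applies. The element `2` is a unit there because `mm'` is odd.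
-/

section DiscreteValuationRing

theorem pow_dvd_pow_mul_sq_iff {R : Type*} [CommRing R] [IsDomain R] {ϖ : R}
    (hϖ : Irreducible ϖ) {i n : ℕ} {a : R} {k : ℕ} {u : Rˣ}
    (ha : a = u * ϖ ^ k) : ϖ ^ i ∣ ϖ ^ n * a ^ 2 ↔ i ≤ n + 2 * k := by
  rw [ha, mul_pow, ← pow_mul', mul_left_comm, ← pow_add, ← Units.val_pow_eq_pow_val,
    Units.dvd_mul_left, pow_dvd_pow_iff hϖ.ne_zero hϖ.not_isUnit]

variable {R : Type*} [CommRing R] [IsDomain R] [IsDiscreteValuationRing R] {ϖ : R}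

theorem pow_dvd_of_pow_dvd_sq (hϖ : Irreducible ϖ) {h : ℕ} {a : R}
    (ha : ϖ ^ (2 * h + 1) ∣ a ^ 2) : ϖ ^ (h + 1) ∣ a := by
  rcases eq_or_ne a 0 with rfl | h0
  · exact dvd_zero _
  obtain ⟨k, u, hu⟩ := IsDiscreteValuationRing.eq_unit_mul_pow_irreducible h0 hϖ
  have hk := (pow_dvd_pow_mul_sq_iff (n := 0) hϖ hu).1 (by simpa using ha)
  rw [hu, Units.dvd_mul_left]
  exact pow_dvd_pow _ (by lia)

theorem pow_dvd_sq_of_forall_dvd_mul_sq_iff (hϖ : Irreducible ϖ) {i j : ℕ} (hij : Odd (i + j))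
    {a b : R} (h : ∀ t, ϖ ^ i ∣ t * a ^ 2 ↔ ϖ ^ j ∣ t * b ^ 2) : ϖ ^ i ∣ a ^ 2 := by
  rcases eq_or_ne a 0 with rfl | ha
  · simp
  rcases eq_or_ne b 0 with rfl | hb
  · simpa using h 1
  obtain ⟨k, u, hu⟩ := IsDiscreteValuationRing.eq_unit_mul_pow_irreducible ha hϖ
  obtain ⟨l, v, hv⟩ := IsDiscreteValuationRing.eq_unit_mul_pow_irreducible hb hϖ
  have key : ∀ n, i ≤ n + 2 * k ↔ j ≤ n + 2 * l := fun n => by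
    rw [← pow_dvd_pow_mul_sq_iff hϖ hu, h, pow_dvd_pow_mul_sq_iff hϖ hv]
  have hik : i ≤ 2 * k := by
    by_contra! hlt
    have h₁ := key (i - 2 * k)
    have h₂ := key (i - 2 * k - 1)
    obtain ⟨m, hm⟩ := hij
    lia
  simpa using (pow_dvd_pow_mul_sq_iff (n := 0) hϖ hu).2 (by lia)

theorem pow_dvd_sq_of_sq_smul_add_mem (hϖ : Irreducible ϖ) {V : Type*} [AddCommGroup V] [Module R V]
    {P : Submodule R V} {x y : V} {i j : ℕ} (hx : ∀ a : R, a • x ∈ P ↔ ϖ ^ i ∣ a)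
    (hy : ∀ a : R, a • y ∈ P ↔ ϖ ^ j ∣ a) (hij : i * j = 0 ∨ Odd (i + j)) {a b : R}
    (h : a ^ 2 • x + b ^ 2 • y ∈ P) : ϖ ^ i ∣ a ^ 2 := by
  rcases hij with hij | hij
  · rcases mul_eq_zero.1 hij with rfl | rfl
    · simp
    · exact (hx _).1 ((Submodule.add_mem_iff_left _ ((hy _).2 (by simp))).1 h)
  refine pow_dvd_sq_of_forall_dvd_mul_sq_iff hϖ hij (b := b) fun t => ?_
  have ht : (t * a ^ 2) • x + (t * b ^ 2) • y ∈ P := by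
    simpa only [smul_add, smul_smul] using Submodule.smul_mem _ t h
  rw [← hx, ← hy]
  exact ⟨fun h' => (Submodule.add_mem_iff_right _ h').1 ht,
    fun h' => (Submodule.add_mem_iff_left _ h').1 ht⟩

theorem length_quotient_span_pow (hϖ : Irreducible ϖ) (n : ℕ) :
    Module.length R (R ⧸ Ideal.span {ϖ ^ n}) = n := by
  have := Ring.ord_pow (mem_nonZeroDivisors_of_ne_zero hϖ.ne_zero) n
  rwa [Ring.ord_of_irreducible hϖ, nsmul_one] at this

theorem exists_eq_smul_or_eq_smul (R : Type*) [CommRing R] [IsDomain R] [ValuationRing R]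
    {K : Type*} [Field K] [Algebra R K] [IsFractionRing R K] (x y : K) :
    ∃ r : R, x = r • y ∨ y = r • x := by
  rcases eq_or_ne y 0 with rfl | hy
  · exact ⟨0, Or.inr (zero_smul R x).symm⟩
  rcases eq_or_ne x 0 with rfl | hx
  · exact ⟨0, Or.inl (zero_smul R y).symm⟩
  rcases ValuationRing.isInteger_or_isInteger R (x / y) with ⟨r, hr⟩ | ⟨r, hr⟩
  · exact ⟨r, Or.inl (by rw [Algebra.smul_def, hr, div_mul_cancel₀ _ hy])⟩
  · exact ⟨r, Or.inr (by rw [Algebra.smul_def, hr, inv_div, div_mul_cancel₀ _ hx])⟩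

theorem exists_smul_mem_one_iff_pow_dvd {K : Type*} [Field K] [Algebra R K] [IsFractionRing R K]
    (hϖ : Irreducible ϖ) (z : K) :
    ∃ n : ℕ, ∀ a : R, a • z ∈ (1 : Submodule R K) ↔ ϖ ^ n ∣ a := by
  obtain ⟨r, hr | hr⟩ := exists_eq_smul_or_eq_smul R z 1
  · refine ⟨0, fun a => iff_of_true ?_ (by simp)⟩
    exact Submodule.smul_mem _ _ (hr ▸ Submodule.smul_mem _ _ (Submodule.one_le.1 le_rfl))
  · obtain ⟨hr0, hz⟩ : r ≠ 0 ∧ z ≠ 0 := smul_ne_zero_iff.1 (hr ▸ one_ne_zero)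
    obtain ⟨n, hn⟩ := IsDiscreteValuationRing.associated_pow_irreducible hr0 hϖ
    refine ⟨n, fun a => ?_⟩
    simp only [← hn.dvd_iff_dvd_left, Submodule.mem_one, Algebra.algebraMap_eq_smul_one, hr,
      smul_smul, (smul_left_injective R hz).eq_iff, dvd_iff_exists_eq_mul_left, eq_comm]

end DiscreteValuationRing

section Presentations

open Submodule

/-- The vectors `e, f ∈ N` generate `N` modulo `M`, with defining relations `a • e, b • f ∈ M`: for
`M ≤ N` this says that `N / M ≅ R / a ⊕ R / b`. -/
structure IsDiagonalPresentation {R V : Type*} [CommRing R] [AddCommGroup V] [Module R V]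
    (M N : Submodule R V) (e f : V) (a b : R) : Prop where
  left_mem : e ∈ N
  right_mem : f ∈ N
  le_span_sup : N ≤ span R {e, f} ⊔ M
  smul_add_smul_mem_iff : ∀ x y : R, x • e + y • f ∈ M ↔ a ∣ x ∧ b ∣ y

/-- Any `n` elements of `N` satisfy a linear relation modulo `M` with a unit coefficient. Over a
local ring and for finitely generated `N / M` this says that `N / M` has fewer than `n`
generators. -/
def HasPrimitiveRelations {R V : Type*} [CommRing R] [AddCommGroup V] [Module R V] (n : ℕ)
    (M N : Submodule R V) : Prop :=
  ∀ v : Fin n → V, (∀ i, v i ∈ N) → ∃ r : Fin n → R, (∃ i, IsUnit (r i)) ∧ ∑ i, r i • v i ∈ M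

variable {R V : Type*} [CommRing R] [AddCommGroup V] [Module R V] {M N : Submodule R V}

theorem exists_smul_add_smul_add_eq {e f : V} (h : N ≤ span R {e, f} ⊔ M) {x : V} (hx : x ∈ N) :
    ∃ a b : R, ∃ z ∈ M, a • e + b • f + z = x := by
  obtain ⟨y, hy, z, hz, rfl⟩ := mem_sup.1 (h hx)
  obtain ⟨a, b, rfl⟩ := mem_span_pair.1 hy
  exact ⟨a, b, z, hz, rfl⟩

namespace IsDiagonalPresentation

theorem nonempty_quotient_linearEquiv {e f : V} {a b : R}
    (h : IsDiagonalPresentation M N e f a b) :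
    Nonempty ((N ⧸ M.submoduleOf N) ≃ₗ[R] (R ⧸ Ideal.span {a}) × (R ⧸ Ideal.span {b})) := by
  let φ : R × R →ₗ[R] N := LinearMap.coprod (LinearMap.toSpanSingleton R N ⟨e, h.left_mem⟩)
    (LinearMap.toSpanSingleton R N ⟨f, h.right_mem⟩)
  let ψ : R × R →ₗ[R] N ⧸ M.submoduleOf N := (M.submoduleOf N).mkQ ∘ₗ φ
  have hker : LinearMap.ker ψ =
      LinearMap.ker ((Ideal.span {a}).mkQ.prodMap (Ideal.span {b}).mkQ) := by
    ext ⟨x, y⟩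
    have hxy : ψ (x, y) = 0 ↔ x • e + y • f ∈ M := Submodule.Quotient.mk_eq_zero _
    rw [LinearMap.mem_ker, hxy, h.smul_add_smul_mem_iff, LinearMap.ker_prodMap, mem_prod,
      ker_mkQ, ker_mkQ, Ideal.mem_span_singleton, Ideal.mem_span_singleton]
  have hsurj : Function.Surjective ψ := fun z => by
    obtain ⟨⟨x, hx⟩, rfl⟩ := mkQ_surjective _ z
    obtain ⟨s, t, m, hm, rfl⟩ := exists_smul_add_smul_add_eq h.le_span_sup hx
    exact ⟨(s, t), (Submodule.Quotient.eq _).2 (neg_mem_iff.1 (by simpa [φ, submoduleOf] using hm))⟩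
  exact ⟨(ψ.quotKerEquivOfSurjective hsurj).symm ≪≫ₗ quotEquivOfEq _ _ hker ≪≫ₗ
    LinearMap.quotKerEquivOfSurjective _ ((mkQ_surjective _).prodMap (mkQ_surjective _))⟩

theorem length_quotient [IsDomain R] [IsDiscreteValuationRing R] {ϖ : R} (hϖ : Irreducible ϖ)
    {e f : V} {i j : ℕ} (h : IsDiagonalPresentation M N e f (ϖ ^ i) (ϖ ^ j)) :
    Module.length R (N ⧸ M.submoduleOf N) = (i + j : ℕ) := by
  obtain ⟨φ⟩ := h.nonempty_quotient_linearEquiv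
  rw [φ.length_eq, Module.length_prod, length_quotient_span_pow hϖ, length_quotient_span_pow hϖ,
    Nat.cast_add]

end IsDiagonalPresentation

theorem exists_isDiagonalPresentation_of_linearEquiv {a b : R}
    (φ : (N ⧸ M.submoduleOf N) ≃ₗ[R] (R ⧸ Ideal.span {a}) × (R ⧸ Ideal.span {b})) :
    ∃ e f : V, IsDiagonalPresentation M N e f a b := by
  obtain ⟨e, he⟩ := mkQ_surjective _ (φ.symm (1, 0))
  obtain ⟨f, hf⟩ := mkQ_surjective _ (φ.symm (0, 1))
  have hφ (x y : R) : φ (mkQ _ (x • e + y • f)) =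
      (Ideal.Quotient.mk _ x, Ideal.Quotient.mk _ y) := by
    rw [map_add, map_smul, map_smul, he, hf, ← map_smul, ← map_smul, ← map_add,
      φ.apply_symm_apply]
    simp [Algebra.smul_def]
  refine ⟨e, f, e.2, f.2, fun z hz => ?_, fun x y => ?_⟩
  · obtain ⟨x, hx⟩ := Ideal.Quotient.mk_surjective (φ (mkQ _ ⟨z, hz⟩)).1
    obtain ⟨y, hy⟩ := Ideal.Quotient.mk_surjective (φ (mkQ _ ⟨z, hz⟩)).2
    have hz' : z - (x • (e : V) + y • (f : V)) ∈ M :=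
      (Submodule.Quotient.eq (M.submoduleOf N)).1 <| φ.injective <|
        ((hφ x y).trans (Prod.ext hx hy)).symm
    rw [← add_sub_cancel (x • (e : V) + y • (f : V)) z]
    exact add_mem (mem_sup_left (mem_span_pair.2 ⟨x, y, rfl⟩)) (mem_sup_right hz')
  · have h0 : mkQ (M.submoduleOf N) (x • e + y • f) = 0 ↔ x • (e : V) + y • (f : V) ∈ M :=
      Submodule.Quotient.mk_eq_zero _
    rw [← h0, ← φ.map_eq_zero_iff, hφ, Prod.mk_eq_zero, Ideal.Quotient.eq_zero_iff_dvd,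
      Ideal.Quotient.eq_zero_iff_dvd]

namespace HasPrimitiveRelations

theorem mono {n : ℕ} {M' N' : Submodule R V} (h : HasPrimitiveRelations n M N) (hM : M ≤ M')
    (hN : N' ≤ N) : HasPrimitiveRelations n M' N' := fun v hv =>
  let ⟨r, hr, hr'⟩ := h v fun i => hN (hv i)
  ⟨r, hr, hM hr'⟩

/-- In a strictly increasing chain the differences are independent modulo the maximal ideal: a
relation between them with last unit coefficient at `i` puts the `i`-th difference into the `i`-th
submodule. -/
theorem not_strictMono {n : ℕ} {C : Fin (n + 1) → Submodule R V}
    (h : HasPrimitiveRelations n (C 0) (C (Fin.last n)))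
    (hC : ∀ r : R, ¬ IsUnit r → ∀ x ∈ C (Fin.last n), r • x ∈ C 0) : ¬ StrictMono C := by
  intro hmono
  choose v hv hv' using fun i : Fin n => SetLike.exists_of_lt (hmono i.castSucc_lt_succ)
  obtain ⟨r, hr, hsum⟩ := h v fun i => hmono.monotone (Fin.le_last _) (hv i)
  obtain ⟨i, hi, hmax⟩ := (Set.toFinite {i | IsUnit (r i)}).exists_maximal hr
  have hother : ∀ j ∈ Finset.univ.erase i, r j • v j ∈ C i.castSucc := by
    intro j hj
    rcases lt_or_ge j i with hji | hji
    · exact smul_mem _ _ (hmono.monotone (Fin.succ_le_castSucc_iff.2 hji) (hv j))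
    · have hrj : ¬ IsUnit (r j) := fun hu =>
        Finset.ne_of_mem_erase hj ((hmax hu hji).antisymm hji)
      exact hmono.monotone (Fin.zero_le _)
        (hC _ hrj _ (hmono.monotone (Fin.le_last _) (hv j)))
  rw [← Finset.add_sum_erase _ _ (Finset.mem_univ i)] at hsum
  have := (Submodule.add_mem_iff_left _ (sum_mem hother)).1 (hmono.monotone (Fin.zero_le _) hsum)
  exact hv' i ((Submodule.smul_mem_iff_of_isUnit _ hi).1 this)

end HasPrimitiveRelations

variable [IsDomain R] [IsDiscreteValuationRing R]

theorem exists_isUnit_sum_smul_eq_zero {m n : ℕ} (hmn : m < n) (a : Fin n → Fin m → R) :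
    ∃ r : Fin n → R, (∃ i, IsUnit (r i)) ∧ ∑ i, r i • a i = 0 := by
  have hdep : ¬ LinearIndependent R a := fun h =>
    hmn.not_ge (by simpa using h.fintype_card_le_finrank)
  obtain ⟨s, hs, i₁, hi₁⟩ := Fintype.not_linearIndependent_iff.1 hdep
  have : Nonempty (Fin n) := ⟨i₁⟩
  obtain ⟨i₀, hi₀⟩ := Finite.exists_min fun i => IsDiscreteValuationRing.addVal R (s i)
  choose r hr using fun i => IsDiscreteValuationRing.addVal_le_iff_dvd.1 (hi₀ i)
  have h0 : s i₀ ≠ 0 := fun h0 => hi₁ (by rw [hr, h0, zero_mul])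
  have hunit : r i₀ = 1 := mul_left_cancel₀ h0 (by rw [mul_one, ← hr])
  have hsum : s i₀ • ∑ i, r i • a i = 0 := by
    rw [Finset.smul_sum, ← hs]
    exact Finset.sum_congr rfl fun i _ => by rw [smul_smul, ← hr]
  exact ⟨r, ⟨i₀, hunit ▸ isUnit_one⟩, (smul_eq_zero.1 hsum).resolve_left h0⟩

theorem hasPrimitiveRelations_of_le_span_sup {m n : ℕ} (hmn : m < n) (e : Fin m → V)
    (h : N ≤ span R (Set.range e) ⊔ M) : HasPrimitiveRelations n M N := by
  intro v hv
  have hcoord : ∀ i, ∃ a : Fin m → R, ∃ z ∈ M, ∑ j, a j • e j + z = v i := fun i => by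
    obtain ⟨y, hy, z, hz, hyz⟩ := mem_sup.1 (h (hv i))
    obtain ⟨a, rfl⟩ := (mem_span_range_iff_exists_fun R).1 hy
    exact ⟨a, z, hz, hyz⟩
  choose a z hz hv using hcoord
  obtain ⟨r, hr, hra⟩ := exists_isUnit_sum_smul_eq_zero hmn a
  refine ⟨r, hr, ?_⟩
  have hlin : ∑ i, r i • ∑ j, a i j • e j = 0 := by
    have := congrArg (Fintype.linearCombination R e) hra
    simpa only [map_sum, map_smul, map_zero, Fintype.linearCombination_apply] using this
  simp only [← hv, smul_add, Finset.sum_add_distrib, hlin, zero_add]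
  exact sum_mem fun i _ => smul_mem _ _ (hz i)

end Presentations

section DualLattice

open Submodule

variable {R K V : Type*} [CommRing R] [Field K] [Algebra R K] [AddCommGroup V] [Module K V]
  [Module R V] [IsScalarTower R K V] {B : LinearMap.BilinForm K V}

theorem dualSubmodule_anti {M N : Submodule R V} (h : M ≤ N) :
    B.dualSubmodule N ≤ B.dualSubmodule M :=
  fun _ hx y hy => hx y (h hy)

theorem le_dualSubmodule_comm (hB : B.IsSymm) {M N : Submodule R V} :
    M ≤ B.dualSubmodule N ↔ N ≤ B.dualSubmodule M := by
  have hflip : B.flip = B := LinearMap.BilinForm.isSymm_iff_flip.1 hB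
  rw [← LinearMap.BilinForm.le_flip_dualSubmodule, hflip]

variable [IsDomain R] [IsPrincipalIdealRing R] [IsFractionRing R K]

theorem exists_basis_span_range_eq (K : Type*) [Field K] [Algebra R K] [Module K V]
    [IsScalarTower R K V] [IsFractionRing R K] (M : Submodule R V) [IsLattice K M] :
    ∃ (n : ℕ) (b : Module.Basis (Fin n) K V), span R (Set.range b) = M := by
  have : Module.Finite R M := IsLattice.finite K M
  have : Module.Free R M := IsLattice.free K M
  refine ⟨_, (Module.finBasis R M).extendOfIsLattice K, ?_⟩
  have hrange : Set.range ((Module.finBasis R M).extendOfIsLattice K) =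
      M.subtype '' Set.range (Module.finBasis R M) := by
    rw [← Set.range_comp]
    exact congrArg Set.range (funext fun i => Module.Basis.extendOfIsLattice_apply K _ i)
  rw [hrange, ← map_span, Module.Basis.span_eq, Submodule.map_top, range_subtype]

theorem dualSubmodule_dualSubmodule (hB : B.IsSymm) (hB' : B.Nondegenerate) (M : Submodule R V)
    [IsLattice K M] : B.dualSubmodule (B.dualSubmodule M) = M := by
  obtain ⟨n, b, rfl⟩ := exists_basis_span_range_eq K M
  exact B.dualSubmodule_dualSubmodule_of_basis hB' hB b

theorem fg_dualSubmodule (hB' : B.Nondegenerate) (M : Submodule R V) [IsLattice K M] :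
    (B.dualSubmodule M).FG := by
  obtain ⟨n, b, rfl⟩ := exists_basis_span_range_eq K M
  rw [B.dualSubmodule_span_of_basis hB']
  exact fg_span (Set.finite_range _)

theorem isLattice_of_le_dualSubmodule (hB' : B.Nondegenerate) {M N : Submodule R V}
    [IsLattice K M] (hMN : M ≤ N) (hN : N ≤ B.dualSubmodule M) : IsLattice K N := by
  have : Module.Finite R (B.dualSubmodule M) := .of_fg (fg_dualSubmodule hB' M)
  have := isNoetherian_of_le hN
  exact .of_le_of_isLattice_of_fg K hMN (Module.Finite.iff_fg.1 inferInstance)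

end DualLattice

section LowerRootLattice

open Submodule

/-- For `M ≤ D`, the preimage in `D` of the lower root `∑ₖ (cₖB ∩ B[cₖ])` of `B = D / M`, where the
sum is over a given family of scalars: the powers of a uniformizer in the local case and all
integers in the global case. -/
def lowerRootLattice {R V ι : Type*} [CommRing R] [AddCommGroup V] [Module R V] (c : ι → R)
    (M D : Submodule R V) : Submodule R V :=
  M ⊔ ⨆ k, D.map (LinearMap.lsmul R V (c k)) ⊓ M.comap (LinearMap.lsmul R V (c k))

variable {R V ι : Type*} [CommRing R] [AddCommGroup V] [Module R V] {c : ι → R}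
  {M D N : Submodule R V}

theorem lowerRootLattice_le_iff : lowerRootLattice c M D ≤ N ↔
    M ≤ N ∧ ∀ k, ∀ y ∈ D, c k • c k • y ∈ M → c k • y ∈ N := by
  rw [lowerRootLattice, sup_le_iff, iSup_le_iff]
  refine and_congr_right fun _ => forall_congr' fun k => ⟨fun h y hy hM => ?_, fun h => ?_⟩
  · exact h ⟨⟨y, hy, rfl⟩, hM⟩
  · rintro _ ⟨⟨y, hy, rfl⟩, hM⟩
    exact h y hy hM

theorem le_lowerRootLattice : M ≤ lowerRootLattice c M D := le_sup_left

theorem smul_mem_lowerRootLattice {k : ι} {y : V} (hy : y ∈ D) (hM : c k • c k • y ∈ M) :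
    c k • y ∈ lowerRootLattice c M D :=
  (lowerRootLattice_le_iff.1 le_rfl).2 k y hy hM

theorem lowerRootLattice_le (hM : M ≤ D) : lowerRootLattice c M D ≤ D :=
  lowerRootLattice_le_iff.2 ⟨hM, fun _ _ hy _ => smul_mem _ _ hy⟩

variable {K : Type*} [Field K] [Algebra R K] [Module K V] [IsScalarTower R K V]
  {B : LinearMap.BilinForm K V}

theorem lowerRootLattice_isotropic (hB : B.IsSymm) (hc : ∀ k l, c k ∣ c l ∨ c l ∣ c k)
    (hM : M ≤ B.dualSubmodule M) :
    lowerRootLattice c M (B.dualSubmodule M) ≤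
      B.dualSubmodule (lowerRootLattice c M (B.dualSubmodule M)) := by
  set D := B.dualSubmodule M
  set L := lowerRootLattice c M D
  have hpair : ∀ k l, c k ∣ c l → ∀ x y, y ∈ D → c k • c k • x ∈ M →
      B (c l • y) (c k • x) ∈ (1 : Submodule R K) := by
    rintro k l ⟨d, hd⟩ x y hy hx
    have := hy _ (M.smul_mem d hx)
    rwa [smul_smul, mul_comm, ← hd, B.smul_right_of_tower, ← B.smul_left_of_tower] at this
  have hML : M ≤ B.dualSubmodule L := (le_dualSubmodule_comm hB).1 (lowerRootLattice_le hM)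
  refine lowerRootLattice_le_iff.2 ⟨hML, fun k x hx hxM => ?_⟩
  rw [← span_singleton_le_iff_mem, le_dualSubmodule_comm hB]
  refine lowerRootLattice_le_iff.2 ⟨?_, fun l y hy hyM z hz => ?_⟩
  · rw [le_dualSubmodule_comm hB, span_singleton_le_iff_mem]
    exact smul_mem _ _ hx
  · obtain ⟨r, rfl⟩ := mem_span_singleton.1 hz
    rw [B.smul_right_of_tower]
    refine smul_mem _ _ ?_
    rcases hc k l with h | h
    · exact hpair k l h x y hy hxM
    · rw [← hB.eq]
      exact hpair l k h y x hx hyM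

end LowerRootLattice

section OrthogonalPair

open Submodule

/-- Generators `e`, `f` of `M† / M`, orthogonal for the symmetric bilinear form `B`, for which
`B e e` and `B f f` have denominators `a` and `b`. -/
structure IsOrthogonalPair {R K V : Type*} [CommRing R] [Field K] [Algebra R K] [AddCommGroup V]
    [Module K V] [Module R V] [IsScalarTower R K V] (B : LinearMap.BilinForm K V)
    (M : Submodule R V) (e f : V) (a b : R) : Prop where
  left_mem : e ∈ B.dualSubmodule M
  right_mem : f ∈ B.dualSubmodule M
  le_span_sup : B.dualSubmodule M ≤ span R {e, f} ⊔ M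
  orthogonal : B e f = 0
  left_iff : ∀ x : R, x • B e e ∈ (1 : Submodule R K) ↔ a ∣ x
  right_iff : ∀ x : R, x • B f f ∈ (1 : Submodule R K) ↔ b ∣ x

namespace IsOrthogonalPair

variable {R K V : Type*} [CommRing R] [Field K] [Algebra R K] [AddCommGroup V] [Module K V]
  [Module R V] [IsScalarTower R K V] {B : LinearMap.BilinForm K V} {M : Submodule R V} {e f : V}
  {a b : R}

theorem symm (hB : B.IsSymm) (h : IsOrthogonalPair B M e f a b) : IsOrthogonalPair B M f e b a where
  left_mem := h.right_mem
  right_mem := h.left_mem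
  le_span_sup := by rw [Set.pair_comm]; exact h.le_span_sup
  orthogonal := by rw [hB.eq]; exact h.orthogonal
  left_iff := h.right_iff
  right_iff := h.left_iff

theorem apply_left (h : IsOrthogonalPair B M e f a b) (x y : R) :
    B e (x • e + y • f) = x • B e e := by
  rw [map_add, B.smul_right_of_tower, B.smul_right_of_tower, h.orthogonal, smul_zero, add_zero]

theorem apply_right (hB : B.IsSymm) (h : IsOrthogonalPair B M e f a b) (x y : R) :
    B f (x • e + y • f) = y • B f f := by
  rw [add_comm]
  exact (h.symm hB).apply_left y x

theorem smul_add_smul_mem (h : IsOrthogonalPair B M e f a b) (x y : R) :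
    x • e + y • f ∈ B.dualSubmodule M :=
  add_mem (smul_mem _ _ h.left_mem) (smul_mem _ _ h.right_mem)

theorem sq_smul_add_sq_smul_mem_one (hB : B.IsSymm) (h : IsOrthogonalPair B M e f a b)
    (hM : M ≤ B.dualSubmodule M) {x y : R} {z : V} (hz : z ∈ M)
    (hv : B (x • e + y • f + z) (x • e + y • f + z) ∈ (1 : Submodule R K)) :
    x ^ 2 • B e e + y ^ 2 • B f f ∈ (1 : Submodule R K) := by
  set w := x • e + y • f with hw
  have hwz : B w z ∈ (1 : Submodule R K) := h.smul_add_smul_mem x y z hz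
  have hzv : B z (w + z) ∈ (1 : Submodule R K) := by
    rw [map_add, ← hB.eq]
    exact add_mem hwz (hM hz z hz)
  have hww : B w w = x ^ 2 • B e e + y ^ 2 • B f f := by
    rw [pow_two, pow_two, mul_smul, mul_smul, ← h.apply_left x y, ← h.apply_right hB x y,
      ← B.smul_left_of_tower, ← B.smul_left_of_tower, ← B.add_left]
  have hsum : B (w + z) (w + z) = B w w + B w z + B z (w + z) := by
    rw [B.add_left, map_add]
  rw [hsum] at hv
  rw [← hww]
  exact (Submodule.add_mem_iff_left _ hwz).1 ((Submodule.add_mem_iff_left _ hzv).1 hv)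

section PrincipalIdealRing

variable [IsDomain R] [IsPrincipalIdealRing R] [IsFractionRing R K] [IsLattice K M]

theorem mem_of_apply_mem_one (hB : B.IsSymm) (hB' : B.Nondegenerate)
    (h : IsOrthogonalPair B M e f a b) {v : V} (hv : v ∈ B.dualSubmodule M)
    (hev : B e v ∈ (1 : Submodule R K)) (hfv : B f v ∈ (1 : Submodule R K)) : v ∈ M := by
  rw [← dualSubmodule_dualSubmodule hB hB' M]
  intro w hw
  obtain ⟨x, y, z, hz, rfl⟩ := exists_smul_add_smul_add_eq h.le_span_sup hw
  rw [map_add, map_add, B.smul_right_of_tower, B.smul_right_of_tower, hB.eq v e, hB.eq v f]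
  exact add_mem (add_mem (smul_mem _ _ hev) (smul_mem _ _ hfv)) (hv z hz)

theorem isDiagonalPresentation (hB : B.IsSymm) (hB' : B.Nondegenerate)
    (h : IsOrthogonalPair B M e f a b) :
    IsDiagonalPresentation M (B.dualSubmodule M) e f a b where
  left_mem := h.left_mem
  right_mem := h.right_mem
  le_span_sup := h.le_span_sup
  smul_add_smul_mem_iff x y := by
    rw [← h.left_iff, ← h.right_iff, ← h.apply_left x y, ← h.apply_right hB x y]
    exact ⟨fun hxy => ⟨h.left_mem _ hxy, h.right_mem _ hxy⟩,
      fun hxy => h.mem_of_apply_mem_one hB hB' (h.smul_add_smul_mem x y) hxy.1 hxy.2⟩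

end PrincipalIdealRing

section DiscreteValuationRing

variable [IsDomain R] [IsDiscreteValuationRing R] {ϖ : R} {i j : ℕ}

theorem dualSubmodule_ne_self_of_odd_left (hB : B.IsSymm) (hϖ : Irreducible ϖ)
    (h : IsOrthogonalPair B M e f (ϖ ^ i) (ϖ ^ j)) (hi : Odd i) (hj : Even j)
    (hM : M ≤ B.dualSubmodule M) {L : Submodule R V} (hL : L ≤ B.dualSubmodule M) :
    B.dualSubmodule L ≠ L := by
  intro hLL
  obtain ⟨n, rfl⟩ := hi
  have hmem : ϖ ^ n • e ∈ B.dualSubmodule L := by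
    intro v hv
    have hvv : B v v ∈ (1 : Submodule R K) := hLL.ge hv v hv
    obtain ⟨x, y, z, hz, rfl⟩ := exists_smul_add_smul_add_eq h.le_span_sup (hL hv)
    obtain ⟨c, rfl⟩ := pow_dvd_of_pow_dvd_sq hϖ <|
      pow_dvd_sq_of_sq_smul_add_mem hϖ h.left_iff h.right_iff
        (.inr ((odd_two_mul_add_one n).add_even hj)) (h.sq_smul_add_sq_smul_mem_one hB hM hz hvv)
    rw [B.smul_left_of_tower, map_add, h.apply_left, smul_add, smul_smul]
    refine add_mem ((h.left_iff _).2 ⟨c, by ring⟩) (smul_mem _ _ (h.left_mem z hz))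
  have hself := hmem _ (hLL.le hmem)
  rw [B.smul_left_of_tower, B.smul_right_of_tower, smul_smul, h.left_iff, ← pow_add,
    pow_dvd_pow_iff hϖ.ne_zero hϖ.not_isUnit] at hself
  lia

theorem dualSubmodule_ne_self (hB : B.IsSymm) (hϖ : Irreducible ϖ)
    (h : IsOrthogonalPair B M e f (ϖ ^ i) (ϖ ^ j)) (hij : Odd (i + j)) (hM : M ≤ B.dualSubmodule M)
    {L : Submodule R V} (hL : L ≤ B.dualSubmodule M) : B.dualSubmodule L ≠ L := by
  rcases Nat.even_or_odd i with hi | hi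
  · exact (h.symm hB).dualSubmodule_ne_self_of_odd_left hB hϖ ((Nat.odd_add'.1 hij).2 hi) hi hM hL
  · exact h.dualSubmodule_ne_self_of_odd_left hB hϖ hi ((Nat.odd_add.1 hij).1 hi) hM hL

variable [IsFractionRing R K] [IsLattice K M]

theorem smul_left_mem_lowerRootLattice (hB : B.IsSymm) (hB' : B.Nondegenerate)
    (hϖ : Irreducible ϖ) (h : IsOrthogonalPair B M e f (ϖ ^ i) (ϖ ^ j)) {x : R}
    (hx : ϖ ^ i ∣ x ^ 2) :
    x • e ∈ lowerRootLattice (fun k : ℕ => ϖ ^ k) M (B.dualSubmodule M) := by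
  rcases eq_or_ne x 0 with rfl | h0
  · rw [zero_smul]
    exact zero_mem _
  obtain ⟨k, u, hu⟩ := IsDiscreteValuationRing.eq_unit_mul_pow_irreducible h0 hϖ
  have hk : ϖ ^ i ∣ ϖ ^ k * ϖ ^ k := by
    rwa [hu, mul_pow, ← Units.val_pow_eq_pow_val, Units.dvd_mul_left, pow_two] at hx
  have hmem := ((h.isDiagonalPresentation hB hB').smul_add_smul_mem_iff _ 0).2 ⟨hk, dvd_zero _⟩
  rw [zero_smul, add_zero, mul_smul] at hmem
  rw [hu, mul_smul]
  exact smul_mem _ _ (smul_mem_lowerRootLattice h.left_mem hmem)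

theorem mem_lowerRootLattice (hB : B.IsSymm) (hB' : B.Nondegenerate) (hϖ : Irreducible ϖ)
    (h : IsOrthogonalPair B M e f (ϖ ^ i) (ϖ ^ j)) (hij : i * j = 0 ∨ Odd (i + j))
    (hM : M ≤ B.dualSubmodule M) {v : V} (hv : v ∈ B.dualSubmodule M)
    (hvv : B v v ∈ (1 : Submodule R K)) :
    v ∈ lowerRootLattice (fun k : ℕ => ϖ ^ k) M (B.dualSubmodule M) := by
  obtain ⟨x, y, z, hz, rfl⟩ := exists_smul_add_smul_add_eq h.le_span_sup hv
  have hxy := h.sq_smul_add_sq_smul_mem_one hB hM hz hvv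
  refine add_mem (add_mem ?_ ?_) (le_lowerRootLattice hz)
  · exact h.smul_left_mem_lowerRootLattice hB hB' hϖ
      (pow_dvd_sq_of_sq_smul_add_mem hϖ h.left_iff h.right_iff hij hxy)
  · rw [add_comm] at hxy
    rw [mul_comm, add_comm] at hij
    exact (h.symm hB).smul_left_mem_lowerRootLattice hB hB' hϖ
      (pow_dvd_sq_of_sq_smul_add_mem hϖ h.right_iff h.left_iff hij hxy)

end DiscreteValuationRing

end IsOrthogonalPair

end OrthogonalPair

section Diagonalisation

open Submodule

theorem exists_eq_smul_or_exists_mem_maximalIdeal_eq_smul (R : Type*) [CommRing R] [IsDomain R]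
    [ValuationRing R] {K : Type*} [Field K] [Algebra R K] [IsFractionRing R K] (x y : K) :
    (∃ r : R, x = r • y) ∨ ∃ r ∈ IsLocalRing.maximalIdeal R, y = r • x := by
  obtain ⟨r, hr | rfl⟩ := exists_eq_smul_or_eq_smul R x y
  · exact .inl ⟨r, hr⟩
  · by_cases hu : IsUnit r
    · obtain ⟨u, rfl⟩ := hu
      exact .inl ⟨↑u⁻¹, by rw [smul_smul, Units.inv_mul, one_smul]⟩
    · exact .inr ⟨r, hu, rfl⟩

variable {R K V : Type*} [CommRing R] [IsDomain R] [IsDiscreteValuationRing R] [Field K]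
  [Algebra R K] [IsFractionRing R K] [AddCommGroup V] [Module K V] [Module R V]
  [IsScalarTower R K V] {B : LinearMap.BilinForm K V} {M : Submodule R V} {ϖ : R}

theorem exists_isOrthogonalPair_of_apply_eq_smul (hϖ : Irreducible ϖ) {e f : V}
    (he : e ∈ B.dualSubmodule M) (hf : f ∈ B.dualSubmodule M)
    (hspan : B.dualSubmodule M ≤ span R {e, f} ⊔ M) {r : R} (hr : B e f = r • B e e) :
    ∃ (e' f' : V) (i j : ℕ), IsOrthogonalPair B M e' f' (ϖ ^ i) (ϖ ^ j) := by
  obtain ⟨i, hi⟩ := exists_smul_mem_one_iff_pow_dvd hϖ (B e e)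
  obtain ⟨j, hj⟩ := exists_smul_mem_one_iff_pow_dvd hϖ (B (f - r • e) (f - r • e))
  refine ⟨e, f - r • e, i, j, he, sub_mem hf (smul_mem _ _ he), hspan.trans ?_, ?_, hi, hj⟩
  · refine sup_le_sup_right (span_le.2 (Set.pair_subset ?_ ?_)) _
    · exact subset_span (by simp)
    · exact mem_span_pair.2 ⟨r, 1, by simp⟩
  · rw [map_sub, B.smul_right_of_tower, hr, sub_self]

/-- If neither `B e e` nor `B f f` divides `B e f`, then `B (e + f) (e + f)` is a unit multiple of
`B e f`, because `2` is a unit. -/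
theorem exists_isOrthogonalPair (hB : B.IsSymm) (hϖ : Irreducible ϖ) (h2 : IsUnit (2 : R)) {e f : V}
    (he : e ∈ B.dualSubmodule M) (hf : f ∈ B.dualSubmodule M)
    (hspan : B.dualSubmodule M ≤ span R {e, f} ⊔ M) :
    ∃ (e' f' : V) (i j : ℕ), IsOrthogonalPair B M e' f' (ϖ ^ i) (ϖ ^ j) := by
  rcases exists_eq_smul_or_exists_mem_maximalIdeal_eq_smul R (B e f) (B e e) with
    ⟨r, hr⟩ | ⟨r, hr, hee⟩
  · exact exists_isOrthogonalPair_of_apply_eq_smul hϖ he hf hspan hr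
  rcases exists_eq_smul_or_exists_mem_maximalIdeal_eq_smul R (B e f) (B f f) with
    ⟨s, hs⟩ | ⟨s, hs, hff⟩
  · rw [← hB.eq] at hs
    rw [Set.pair_comm] at hspan
    exact exists_isOrthogonalPair_of_apply_eq_smul hϖ hf he hspan hs
  obtain ⟨u, hu⟩ : IsUnit (r + s + 2) := by
    by_contra hu
    exact (Ideal.add_mem_iff_right (IsLocalRing.maximalIdeal R) (add_mem hr hs)).1 hu h2
  have hsum : B (e + f) (e + f) = u • B e f := by
    rw [Units.smul_def, hu, B.add_left, map_add, map_add, hB.eq f e, hee, hff]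
    module
  refine exists_isOrthogonalPair_of_apply_eq_smul hϖ (add_mem he hf) hf
    (hspan.trans (sup_le_sup_right (span_le.2 (Set.pair_subset ?_ ?_)) _))
    (r := (1 + s) * ↑u⁻¹) ?_
  · exact mem_span_pair.2 ⟨1, -1, by simp⟩
  · exact subset_span (by simp)
  · rw [hsum, mul_smul, ← Units.smul_def, inv_smul_smul, B.add_left, hff, add_smul, one_smul]

end Diagonalisation

section Trace

open Submodule

theorem isIntegral_of_mem_spectrum {R L A : Type*} [CommRing R] [Field L] [Algebra R L] [Ring A]
    [Algebra L A] [Algebra R A] [IsScalarTower R L A] {a : A} (ha : IsIntegral R a) {μ : L}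
    (hμ : μ ∈ spectrum L a) : IsIntegral R μ := by
  obtain ⟨p, hp, hpa⟩ := ha
  have hmem : (p.map (algebraMap R L)).eval μ ∈ spectrum L (0 : A) := by
    rw [← hpa, ← Polynomial.aeval_def, ← Polynomial.aeval_map_algebraMap L]
    exact spectrum.subset_polynomial_aeval a _ ⟨μ, hμ, rfl⟩
  have : Nontrivial A := not_subsingleton_iff_nontrivial.1 fun _ => by
    rwa [spectrum.of_subsingleton] at hmem
  rw [spectrum.zero_eq, Set.mem_singleton_iff, Polynomial.eval_map] at hmem
  exact ⟨p, hp, hmem⟩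

theorem isIntegral_trace_of_finite {R K E : Type*} [CommRing R] [Field K] [Algebra R K]
    [CommRing E] [Algebra K E] [Algebra R E] [IsScalarTower R K E] [Module.Finite K E] {x : E}
    (hx : IsIntegral R x) : IsIntegral R (Algebra.trace K E x) := by
  let b := Module.finBasis K E
  let φ : E →ₐ[R] Matrix _ _ (AlgebraicClosure K) :=
    ((Algebra.ofId K (AlgebraicClosure K)).mapMatrix.comp
      (Algebra.leftMulMatrix b)).restrictScalars R
  have htrace : algebraMap K (AlgebraicClosure K) (Algebra.trace K E x) = (φ x).trace := by
    rw [Algebra.trace_eq_matrix_trace b]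
    exact AddMonoidHom.map_trace (algebraMap K (AlgebraicClosure K)).toAddMonoidHom _
  rw [← isIntegral_algebraMap_iff (algebraMap K (AlgebraicClosure K)).injective, htrace,
    Matrix.trace_eq_sum_roots_charpoly]
  exact IsIntegral.multiset_sum fun μ hμ => isIntegral_of_mem_spectrum (hx.map φ)
    (Matrix.mem_spectrum_iff_isRoot_charpoly.2 (Polynomial.isRoot_of_mem_roots hμ))

variable {R K Q : Type*} [CommRing R] [Field K] [Algebra R K] [IsFractionRing R K]
  [CommRing Q] [Algebra K Q] [Algebra R Q] [IsScalarTower R K Q]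

theorem exists_smul_mem_of_isLattice {V : Type*} [AddCommGroup V] [Module K V] [Module R V]
    [IsScalarTower R K V] (M : Submodule R V) [IsLattice K M] (x : V) :
    ∃ r : nonZeroDivisors R, r • x ∈ M := by
  have hx : x ∈ span K (M : Set V) := IsLattice.span_eq_top (M := M) ▸ mem_top
  obtain ⟨y, hy, r, rfl⟩ := (IsLocalization.mem_span_iff (nonZeroDivisors R)).1 hx
  rw [span_eq] at hy
  refine ⟨r, ?_⟩
  rwa [Submonoid.smul_def, ← IsScalarTower.algebraMap_smul K, smul_smul,
    IsLocalization.mk'_spec'_mk, map_one, one_smul]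

theorem isLocalization_of_isLattice (S : Subalgebra R Q)
    [IsLattice K (Subalgebra.toSubmodule S)] :
    IsLocalization (Algebra.algebraMapSubmonoid S (nonZeroDivisors R)) Q where
  map_units := by
    rintro ⟨_, r, hr, rfl⟩
    have hunit := (IsLocalization.map_units K ⟨r, hr⟩).map (algebraMap K Q)
    rwa [← IsScalarTower.algebraMap_apply] at hunit
  surj z := by
    obtain ⟨r, hr⟩ := exists_smul_mem_of_isLattice (Subalgebra.toSubmodule S) z
    refine ⟨(⟨r • z, hr⟩, ⟨algebraMap R S r, r, r.2, rfl⟩), ?_⟩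
    rw [mul_comm]
    exact (Algebra.smul_def (r : R) z).symm
  exists_of_eq h := ⟨1, by rw [Subtype.val_injective h]⟩

theorem algebraMap_trace_of_isLattice [IsDomain R] [IsPrincipalIdealRing R] (S : Subalgebra R Q)
    [IsLattice K (Subalgebra.toSubmodule S)] (x : S) :
    algebraMap R K (Algebra.trace R S x) = Algebra.trace K Q (x : Q) := by
  have := isLocalization_of_isLattice (K := K) S
  have : Module.Finite R S := IsLattice.finite K (Subalgebra.toSubmodule S)
  have : Module.Free R S := IsLattice.free K (Subalgebra.toSubmodule S)
  exact (Algebra.trace_localization R (nonZeroDivisors R) x).symm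

end Trace

section Tame

open Submodule IsLocalRing

section FiniteDimensional

variable {k E : Type*} [Field k] [CommRing E] [Algebra k E] [Module.Finite k E]

/-- The trace of an idempotent is the dimension of the ideal that it generates. -/
theorem eq_zero_of_trace_eq_zero_of_isIdempotentElem (h2 : (2 : k) ≠ 0) {ε : E}
    (hε : IsIdempotentElem ε) (htr : Algebra.trace k E ε = 0) {N : Ideal E} (hN : ε ∈ N)
    (hrank : Module.finrank k (N.restrictScalars k) ≤ 2) : ε = 0 := by
  set f := Algebra.lmul k E ε
  have hproj : LinearMap.IsProj (LinearMap.range f) f := by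
    refine ⟨fun z => ⟨z, rfl⟩, ?_⟩
    rintro _ ⟨z, rfl⟩
    change ε * (ε * z) = ε * z
    rw [← mul_assoc, hε.eq]
  have htrace : (Module.finrank k (LinearMap.range f) : k) = 0 := by
    rw [← hproj.trace, ← Algebra.trace_apply, htr]
  have hle : Module.finrank k (LinearMap.range f) ≤ 2 := by
    refine (Submodule.finrank_mono ?_).trans hrank
    rintro _ ⟨z, rfl⟩
    exact N.mul_mem_right z hN
  have hzero : Module.finrank k (LinearMap.range f) = 0 := by
    generalize Module.finrank k (LinearMap.range f) = d at htrace hle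
    interval_cases d
    · rfl
    · simp at htrace
    · exact absurd htrace h2
  have hbot : LinearMap.range f = ⊥ := Submodule.finrank_eq_zero.1 hzero
  simpa [f] using (Submodule.eq_bot_iff _).1 hbot (f 1) ⟨1, rfl⟩

theorem exists_isIdempotentElem_span_eq_pow {E : Type*} [CommRing E] [IsArtinianRing E] (x : E) :
    ∃ (n : ℕ) (ε : E), n ≠ 0 ∧ IsIdempotentElem ε ∧ Ideal.span {ε} = Ideal.span {x} ^ n := by
  let g : ℕ →o (Ideal E)ᵒᵈ :=
    ⟨fun n => OrderDual.toDual (Ideal.span {x} ^ n), fun _ _ h => Ideal.pow_le_pow_right h⟩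
  obtain ⟨n, hn⟩ := IsArtinian.monotone_stabilizes g
  have hpow : ∀ m, n ≤ m → Ideal.span {x} ^ n = Ideal.span {x} ^ m := hn
  have hid : IsIdempotentElem (Ideal.span {x} ^ (n + 1)) := by
    rw [IsIdempotentElem, ← pow_add, ← hpow (n + 1) (by lia), ← hpow _ (by lia)]
  obtain ⟨ε, hε, h⟩ := (Ideal.isIdempotentElem_iff_of_fg _
    ((Submodule.fg_span_singleton x).pow _)).1 hid
  exact ⟨n + 1, ε, n.succ_ne_zero, hε, h.symm⟩

theorem isNilpotent_of_trace_eq_zero (h2 : (2 : k) ≠ 0) {N : Ideal E}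
    (htr : ∀ x ∈ N, Algebra.trace k E x = 0)
    (hrank : Module.finrank k (N.restrictScalars k) ≤ 2) {x : E} (hx : x ∈ N) :
    IsNilpotent x := by
  have : IsArtinianRing E := IsArtinianRing.of_finite k E
  obtain ⟨n, ε, hn, hε, hspan⟩ := exists_isIdempotentElem_span_eq_pow x
  have hεN : ε ∈ N := by
    rw [← Ideal.span_singleton_le_iff_mem, hspan]
    exact (Ideal.pow_le_self hn).trans ((Ideal.span_singleton_le_iff_mem N).2 hx)
  have hε0 := eq_zero_of_trace_eq_zero_of_isIdempotentElem h2 hε (htr ε hεN) hεN hrank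
  rw [Ideal.span_singleton_pow, hε0, Ideal.span_singleton_zero, eq_comm,
    Ideal.span_singleton_eq_bot] at hspan
  exact ⟨n, hspan⟩

end FiniteDimensional

attribute [local instance] Ideal.Quotient.field

theorem finrank_map_mk_lt_of_hasPrimitiveRelations {R S : Type*} [CommRing R] [IsLocalRing R]
    [CommRing S] [Algebra R S] {n : ℕ} {N : Ideal S}
    (hrel : HasPrimitiveRelations n (((maximalIdeal R).map (algebraMap R S)).restrictScalars R)
      (N.restrictScalars R)) :
    Module.finrank (R ⧸ maximalIdeal R)
      ((N.map (Ideal.Quotient.mk ((maximalIdeal R).map (algebraMap R S)))).restrictScalars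
        (R ⧸ maximalIdeal R)) < n := by
  set 𝔪 := maximalIdeal R
  set I := 𝔪.map (algebraMap R S)
  by_contra! hle
  obtain ⟨v, hv⟩ := exists_linearIndependent_of_le_finrank hle
  choose z hzN hz using fun i =>
    (Ideal.mem_map_iff_of_surjective _ Ideal.Quotient.mk_surjective).1 (v i).2
  obtain ⟨r, ⟨i, hi⟩, hr⟩ := hrel z hzN
  have hzero : Ideal.Quotient.mk I (∑ i, r i • z i) = 0 := Ideal.Quotient.eq_zero_iff_mem.2 hr
  have hsum : ∑ i, Ideal.Quotient.mk 𝔪 (r i) • v i = 0 := by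
    refine Subtype.ext (Eq.trans ?_ hzero)
    rw [map_sum, coe_sum]
    refine Finset.sum_congr rfl fun i _ => ?_
    rw [Algebra.smul_def, map_mul, hz, coe_smul, Algebra.smul_def]
    rfl
  exact Ideal.Quotient.eq_zero_iff_mem.1 (Fintype.linearIndependent_iff.1 hv _ hsum i) hi

theorem le_radical_map_maximalIdeal {R S : Type*} [CommRing R] [IsLocalRing R] [CommRing S]
    [Algebra R S] [Module.Free R S] [Module.Finite R S] (h2 : IsUnit (2 : R)) {N : Ideal S}
    (htr : ∀ x ∈ N, Algebra.trace R S x ∈ maximalIdeal R)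
    (hrel : HasPrimitiveRelations 3 (((maximalIdeal R).map (algebraMap R S)).restrictScalars R)
      (N.restrictScalars R)) : N ≤ ((maximalIdeal R).map (algebraMap R S)).radical := by
  set 𝔪 := maximalIdeal R
  set I := 𝔪.map (algebraMap R S)
  have : Module.Finite (R ⧸ 𝔪) (S ⧸ I) := Module.Finite.of_restrictScalars_finite R _ _
  have h2' : (2 : R ⧸ 𝔪) ≠ 0 := fun h => (Ideal.Quotient.eq_zero_iff_mem (a := (2 : R))).1 h h2
  have htr' : ∀ x ∈ N.map (Ideal.Quotient.mk I), Algebra.trace (R ⧸ 𝔪) (S ⧸ I) x = 0 := by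
    intro x hx
    obtain ⟨x, hxN, rfl⟩ := (Ideal.mem_map_iff_of_surjective _ Ideal.Quotient.mk_surjective).1 hx
    rw [Algebra.trace_quotient_mk, Ideal.Quotient.eq_zero_iff_mem]
    exact htr x hxN
  intro x hx
  obtain ⟨n, hn⟩ := isNilpotent_of_trace_eq_zero h2' htr'
    (Nat.le_of_lt_succ (finrank_map_mk_lt_of_hasPrimitiveRelations hrel))
    (Ideal.mem_map_of_mem (Ideal.Quotient.mk I) hx)
  exact ⟨n, by rwa [← map_pow, Ideal.Quotient.eq_zero_iff_mem] at hn⟩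

end Tame

section TraceDual

open Submodule IsLocalRing

section IntegralClosure

variable {R Q : Type*} [CommRing R] [CommRing Q] [Algebra R Q]

theorem isIntegral_of_forall_mul_mem {N : Submodule R Q} (hN : N.FG)
    (hN0 : ∀ x : Q, (∀ n ∈ N, x * n = 0) → x = 0) {x : Q} (hx : ∀ n ∈ N, x * n ∈ N) :
    IsIntegral R x := by
  have : Module.Finite R N := .of_fg hN
  let stab : Subalgebra R Q :=
    { carrier := {y | ∀ n ∈ N, y * n ∈ N}
      mul_mem' := fun ha hb n hn => mul_assoc _ _ n ▸ ha _ (hb n hn)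
      add_mem' := fun ha hb n hn => add_mul _ _ n ▸ add_mem (ha n hn) (hb n hn)
      algebraMap_mem' := fun r n hn => Algebra.smul_def r n ▸ N.smul_mem r hn }
  let f : stab →ₐ[R] Module.End R N := AlgHom.ofLinearMap
    { toFun := fun y => (LinearMap.mulLeft R (y : Q)).restrict y.2
      map_add' := fun y z => LinearMap.ext fun n => Subtype.ext (add_mul (y : Q) z n)
      map_smul' := fun r y => LinearMap.ext fun n => Subtype.ext (smul_mul_assoc r (y : Q) n) }
    (LinearMap.ext fun n => Subtype.ext (one_mul (n : Q)))
    fun y z => LinearMap.ext fun n => Subtype.ext (mul_assoc (y : Q) z n)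
  have hf : Function.Injective f := (injective_iff_map_eq_zero f).2 fun y hy =>
    Subtype.ext (hN0 y fun n hn => congrArg Subtype.val (LinearMap.congr_fun hy ⟨n, hn⟩))
  have hint : IsIntegral R (⟨x, hx⟩ : stab) :=
    (isIntegral_algHom_iff f hf).1 (Algebra.IsIntegral.isIntegral (R := R) (A := Module.End R N) _)
  exact hint.map stab.val

/-- An element `j * z` with `j ∈ J ^ n` maps `J` into `P ∩ integralClosure R Q`, hence into `J`, so
it is integral. -/
theorem mem_integralClosure_of_forall_pow_mul_mem {P : Submodule R Q}
    (hP : ∀ s : integralClosure R Q, ∀ z ∈ P, s * z ∈ P) {J : Ideal (integralClosure R Q)}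
    (hPJ : ∀ s : integralClosure R Q, (s : Q) ∈ P → s ∈ J) (hJ : (J.restrictScalars R).FG)
    (hJ0 : ∀ x : Q, (∀ j ∈ J, x * j = 0) → x = 0) (n : ℕ) {z : Q} (hz : z ∈ P)
    (hzJ : ∀ j ∈ J ^ n, j * z ∈ integralClosure R Q) : z ∈ integralClosure R Q := by
  induction n with
  | zero => simpa using hzJ 1 (by simp)
  | succ n ih =>
    refine ih fun j hj => isIntegral_of_forall_mul_mem
      (hJ.map (integralClosure R Q).val.toLinearMap)
      (fun x hx => hJ0 x fun i hi => hx i ⟨i, hi, rfl⟩) ?_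
    rintro _ ⟨i, hi, rfl⟩
    have hmul : (j * z) * i = (j * i : integralClosure R Q) * z := by
      rw [MulMemClass.coe_mul, mul_right_comm]
    have hint : (j * i : integralClosure R Q) * z ∈ integralClosure R Q :=
      hzJ _ (pow_succ J n ▸ Ideal.mul_mem_mul hj hi)
    refine ⟨⟨_, hint⟩, hPJ _ (hP _ _ hz), hmul.symm⟩

end IntegralClosure

variable {R K Q : Type*} [CommRing R] [Field K] [Algebra R K] [CommRing Q] [Algebra K Q]
  [Algebra R Q] [IsScalarTower R K Q]

theorem mul_mem_traceForm_dualSubmodule (S : Subalgebra R Q) (s : S) {z : Q}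
    (hz : z ∈ (Algebra.traceForm K Q).dualSubmodule (Subalgebra.toSubmodule S)) :
    s * z ∈ (Algebra.traceForm K Q).dualSubmodule (Subalgebra.toSubmodule S) := by
  intro y hy
  have hmul : Algebra.traceForm K Q (s * z) y = Algebra.traceForm K Q z (s * y) := by
    rw [Algebra.traceForm_apply, Algebra.traceForm_apply, mul_comm (s : Q) z, mul_assoc]
  rw [hmul]
  exact hz _ (S.mul_mem s.2 hy)

variable [IsDomain R] [IsDiscreteValuationRing R] [IsFractionRing R K] {ϖ : R}

theorem exists_pow_smul_mem_of_isLattice (hϖ : Irreducible ϖ) {V : Type*} [AddCommGroup V]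
    [Module K V] [Module R V] [IsScalarTower R K V] (M : Submodule R V) [IsLattice K M] (x : V) :
    ∃ n : ℕ, ϖ ^ n • x ∈ M := by
  obtain ⟨r, hr⟩ := exists_smul_mem_of_isLattice M x
  obtain ⟨n, u, hu⟩ :=
    IsDiscreteValuationRing.eq_unit_mul_pow_irreducible (nonZeroDivisors.coe_ne_zero r) hϖ
  rw [Submonoid.smul_def, hu, mul_smul] at hr
  exact ⟨n, (Submodule.smul_mem_iff_of_isUnit _ u.isUnit).1 hr⟩

theorem mem_map_maximalIdeal_pow_iff (hϖ : Irreducible ϖ) {S : Type*} [CommRing S] [Algebra R S]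
    {n : ℕ} {s : S} :
    s ∈ (maximalIdeal R).map (algebraMap R S) ^ n ↔ ∃ t : S, s = ϖ ^ n • t := by
  rw [hϖ.maximalIdeal_eq, Ideal.map_span, Set.image_singleton, Ideal.span_singleton_pow,
    Ideal.mem_span_singleton, ← map_pow]
  exact exists_congr fun t => by rw [Algebra.smul_def]

theorem mem_radical_map_maximalIdeal_of_eq_smul (hϖ : Irreducible ϖ) (h2 : IsUnit (2 : R))
    (S : Subalgebra R Q) [IsLattice K (Subalgebra.toSubmodule S)]
    (hrel : HasPrimitiveRelations 3 (Subalgebra.toSubmodule S)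
      ((Algebra.traceForm K Q).dualSubmodule (Subalgebra.toSubmodule S))) {s : S} {z : Q}
    (hz : z ∈ (Algebra.traceForm K Q).dualSubmodule (Subalgebra.toSubmodule S))
    (hs : (s : Q) = ϖ • z) : s ∈ ((maximalIdeal R).map (algebraMap R S)).radical := by
  have := IsLattice.finite K (Subalgebra.toSubmodule S)
  have := IsLattice.free K (Subalgebra.toSubmodule S)
  set D := (Algebra.traceForm K Q).dualSubmodule (Subalgebra.toSubmodule S)
  let N : Ideal S :=
    { carrier := {s | ∃ z ∈ D, (s : Q) = ϖ • z}
      zero_mem' := ⟨0, zero_mem _, (smul_zero ϖ).symm⟩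
      add_mem' := by
        rintro s t ⟨y, hy, hs⟩ ⟨z, hz, ht⟩
        exact ⟨y + z, add_mem hy hz, by rw [AddMemClass.coe_add, hs, ht, smul_add]⟩
      smul_mem' := by
        rintro t s ⟨z, hz, hs⟩
        exact ⟨t * z, mul_mem_traceForm_dualSubmodule S t hz, by
          rw [smul_eq_mul, MulMemClass.coe_mul, hs, mul_smul_comm]⟩ }
  refine le_radical_map_maximalIdeal h2 (N := N) ?_ ?_ ⟨z, hz, hs⟩
  · rintro s ⟨z, hz, hs⟩
    obtain ⟨r, hr⟩ := mem_one.1 (hz 1 S.one_mem)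
    have htrace : algebraMap R K (Algebra.trace R S s) = algebraMap R K (ϖ * r) := by
      rw [algebraMap_trace_of_isLattice, hs, map_mul, hr, Algebra.traceForm_apply, mul_one,
        LinearMap.map_smul_of_tower, Algebra.smul_def]
    rw [IsFractionRing.injective R K htrace, hϖ.maximalIdeal_eq]
    exact Ideal.mul_mem_right r _ (Ideal.mem_span_singleton_self ϖ)
  · intro v hv
    choose z hz hv using hv
    obtain ⟨r, hr, hsum⟩ := hrel z hz
    rw [← pow_one (Ideal.map _ _)]
    refine ⟨r, hr, (mem_map_maximalIdeal_pow_iff hϖ).2 ⟨⟨_, hsum⟩, Subtype.ext ?_⟩⟩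
    simp only [pow_one, AddSubmonoidClass.coe_finsetSum, SetLike.val_smul, hv, Finset.smul_sum,
      smul_comm ϖ]

/-- For `J = √(ϖO)`, where `O` is the integral closure, `ϖO† ∩ O ⊆ J` by nilpotence of elements of
trace zero, and `Jⁿ ϖz ⊆ O` for large `n`. -/
theorem smul_mem_integralClosure_of_mem_dualSubmodule (hϖ : Irreducible ϖ) (h2 : IsUnit (2 : R))
    [IsLattice K (Subalgebra.toSubmodule (integralClosure R Q))]
    (hrel : HasPrimitiveRelations 3 (Subalgebra.toSubmodule (integralClosure R Q))
      ((Algebra.traceForm K Q).dualSubmodule (Subalgebra.toSubmodule (integralClosure R Q))))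
    {z : Q} (hz : z ∈ (Algebra.traceForm K Q).dualSubmodule
      (Subalgebra.toSubmodule (integralClosure R Q))) : ϖ • z ∈ integralClosure R Q := by
  set O := integralClosure R Q
  set D := (Algebra.traceForm K Q).dualSubmodule (Subalgebra.toSubmodule O)
  set I := (maximalIdeal R).map (algebraMap R O)
  have : Module.Finite R O := IsLattice.finite K (Subalgebra.toSubmodule O)
  have hnoeth : IsNoetherian R O := isNoetherian_of_isNoetherianRing_of_finite R O
  have : IsNoetherianRing O := isNoetherian_of_tower R hnoeth
  obtain ⟨n, hn⟩ := Ideal.exists_radical_pow_le_of_fg I I.radical.fg_of_isNoetherianRing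
  obtain ⟨m, hm⟩ :=
    exists_pow_smul_mem_of_isLattice (K := K) hϖ (Subalgebra.toSubmodule O) (ϖ • z)
  refine mem_integralClosure_of_forall_pow_mul_mem (P := D.map (LinearMap.lsmul R Q ϖ))
    (J := I.radical) ?_ ?_ (IsNoetherian.noetherian _) (fun x hx => ?_) (n * m) ⟨z, hz, rfl⟩
    fun j hj => ?_
  · rintro s _ ⟨y, hy, rfl⟩
    exact ⟨s * y, mul_mem_traceForm_dualSubmodule O s hy, (mul_smul_comm ϖ (s : Q) y).symm⟩
  · rintro s ⟨y, hy, hs⟩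
    exact mem_radical_map_maximalIdeal_of_eq_smul hϖ h2 O hrel hy hs.symm
  · have hϖI : algebraMap R O ϖ ∈ I :=
      Ideal.mem_map_of_mem _ (hϖ.maximalIdeal_eq ▸ Ideal.mem_span_singleton_self ϖ)
    have hϖx : algebraMap R K ϖ • x = 0 := by
      rw [IsScalarTower.algebraMap_smul, Algebra.smul_def, mul_comm]
      exact hx _ (Ideal.le_radical hϖI)
    exact (smul_eq_zero.1 hϖx).resolve_left (by simpa using hϖ.ne_zero)
  · rw [pow_mul] at hj
    obtain ⟨t, rfl⟩ := (mem_map_maximalIdeal_pow_iff hϖ).1 (Ideal.pow_right_mono hn m hj)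
    rw [SetLike.val_smul, smul_mul_assoc, ← mul_smul_comm]
    exact O.mul_mem t.2 hm

end TraceDual

section LocalTheorem

open Submodule

theorem smul_mem_of_not_isUnit {R V : Type*} [CommRing R] [IsDomain R] [IsDiscreteValuationRing R]
    [AddCommGroup V] [Module R V] {M : Submodule R V} {ϖ r : R} (hϖ : Irreducible ϖ) {z : V}
    (hz : ϖ • z ∈ M) (hr : ¬ IsUnit r) : r • z ∈ M := by
  have hmem : r ∈ IsLocalRing.maximalIdeal R := hr
  rw [hϖ.maximalIdeal_eq, Ideal.mem_span_singleton'] at hmem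
  obtain ⟨c, rfl⟩ := hmem
  rw [mul_smul]
  exact smul_mem _ _ hz

namespace IsDiagonalPresentation

section CommRing

variable {R V : Type*} [CommRing R] [AddCommGroup V] [Module R V] {M N : Submodule R V} {e f : V}

theorem symm {a b : R} (h : IsDiagonalPresentation M N e f a b) :
    IsDiagonalPresentation M N f e b a where
  left_mem := h.right_mem
  right_mem := h.left_mem
  le_span_sup := by rw [Set.pair_comm]; exact h.le_span_sup
  smul_add_smul_mem_iff x y := by rw [add_comm, h.smul_add_smul_mem_iff, and_comm]

theorem of_associated {a b a' b' : R} (h : IsDiagonalPresentation M N e f a b)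
    (ha : Associated a a') (hb : Associated b b') : IsDiagonalPresentation M N e f a' b' where
  left_mem := h.left_mem
  right_mem := h.right_mem
  le_span_sup := h.le_span_sup
  smul_add_smul_mem_iff x y := by
    rw [h.smul_add_smul_mem_iff, ha.dvd_iff_dvd_left, hb.dvd_iff_dvd_left]

theorem le_span_singleton_sup {a : R} (h : IsDiagonalPresentation M N e f a 1) :
    N ≤ span R {e} ⊔ M := by
  have hf : f ∈ M := by
    simpa using (h.smul_add_smul_mem_iff 0 1).2 ⟨dvd_zero a, dvd_rfl⟩
  refine h.le_span_sup.trans (sup_le (span_le.2 (Set.pair_subset ?_ ?_)) le_sup_right)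
  · exact mem_sup_left (mem_span_singleton_self e)
  · exact mem_sup_right hf

end CommRing

variable {R V : Type*} [CommRing R] [IsDomain R] [IsDiscreteValuationRing R] [AddCommGroup V]
  [Module R V] {M N : Submodule R V} {e f : V}

theorem hasPrimitiveRelations_three {a b : R} (h : IsDiagonalPresentation M N e f a b) :
    HasPrimitiveRelations 3 M N :=
  hasPrimitiveRelations_of_le_span_sup (by lia) ![e, f] <| by
    rw [Matrix.range_cons_cons_empty]
    exact h.le_span_sup

theorem hasPrimitiveRelations_two_of_right_eq_one {a : R} (h : IsDiagonalPresentation M N e f a 1) :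
    HasPrimitiveRelations 2 M N :=
  hasPrimitiveRelations_of_le_span_sup (by lia) ![e] <| by
    rw [Matrix.range_cons, Matrix.range_empty, Set.union_empty]
    exact h.le_span_singleton_sup

theorem hasPrimitiveRelations_two {ϖ : R} {i j : ℕ}
    (h : IsDiagonalPresentation M N e f (ϖ ^ i) (ϖ ^ j)) (hij : i * j = 0) :
    HasPrimitiveRelations 2 M N := by
  rcases mul_eq_zero.1 hij with rfl | rfl
  · rw [pow_zero] at h
    exact h.symm.hasPrimitiveRelations_two_of_right_eq_one
  · rw [pow_zero] at h
    exact h.hasPrimitiveRelations_two_of_right_eq_one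

end IsDiagonalPresentation

section BilinForm

variable {R K V : Type*} [CommRing R] [IsDomain R] [IsDiscreteValuationRing R] [Field K]
  [Algebra R K] [IsFractionRing R K] [AddCommGroup V] [Module K V] [Module R V]
  [IsScalarTower R K V] {B : LinearMap.BilinForm K V} {M : Submodule R V} [IsLattice K M] {e f : V}
  {ϖ : R} {i j : ℕ}

/-- Otherwise `O < L ≤ L† < O†` for the lower root `L`, which leaves no room: `O† / O` is a vector
space of dimension at most one if `i * j = 0`, and otherwise of dimension at most two, with
`L ≠ L†`. -/
theorem IsOrthogonalPair.eq_lowerRootLattice (hB : B.IsSymm) (hB' : B.Nondegenerate)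
    (hϖ : Irreducible ϖ) (h : IsOrthogonalPair B M e f (ϖ ^ i) (ϖ ^ j))
    (hij : i * j = 0 ∨ Odd (i + j)) {O : Submodule R V} (hMO : M ≤ O) (hO : O ≤ B.dualSubmodule O)
    (hϖO : ∀ z ∈ B.dualSubmodule O, ϖ • z ∈ O) :
    O = lowerRootLattice (fun k : ℕ => ϖ ^ k) M (B.dualSubmodule M) := by
  set L := lowerRootLattice (fun k : ℕ => ϖ ^ k) M (B.dualSubmodule M)
  have hOM : B.dualSubmodule O ≤ B.dualSubmodule M := dualSubmodule_anti hMO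
  have hM : M ≤ B.dualSubmodule M := hMO.trans (hO.trans hOM)
  have hOL : O ≤ L := fun v hv =>
    h.mem_lowerRootLattice hB hB' hϖ hij hM (hOM (hO hv)) (hO hv v hv)
  have hLL : L ≤ B.dualSubmodule L :=
    lowerRootLattice_isotropic hB (fun k l => (le_total k l).imp (pow_dvd_pow ϖ) (pow_dvd_pow ϖ)) hM
  have hLM : L ≤ B.dualSubmodule M := lowerRootLattice_le hM
  have := isLattice_of_le_dualSubmodule hB' hMO (hO.trans hOM)
  have := isLattice_of_le_dualSubmodule hB' le_lowerRootLattice hLM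
  by_contra hne
  have hOL' : O < L := lt_of_le_of_ne hOL hne
  have hLO' : B.dualSubmodule L < B.dualSubmodule O := by
    refine lt_of_le_of_ne (dualSubmodule_anti hOL) fun heq => hne ?_
    rw [← dualSubmodule_dualSubmodule hB hB' O, ← heq, dualSubmodule_dualSubmodule hB hB' L]
  have hkill : ∀ r : R, ¬ IsUnit r → ∀ z ∈ B.dualSubmodule O, r • z ∈ O := fun r hr z hz =>
    smul_mem_of_not_isUnit hϖ (hϖO z hz) hr
  have hpres := h.isDiagonalPresentation hB hB'
  rcases hij with hij | hij
  · refine HasPrimitiveRelations.not_strictMono (C := ![O, L, B.dualSubmodule O])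
      ((hpres.hasPrimitiveRelations_two hij).mono hMO hOM) hkill (Fin.strictMono_iff_lt_succ.2 ?_)
    exact Fin.forall_fin_two.2 ⟨hOL', hLL.trans_lt hLO'⟩
  · have hLL' : L < B.dualSubmodule L :=
      lt_of_le_of_ne hLL (h.dualSubmodule_ne_self hB hϖ hij hM hLM).symm
    refine HasPrimitiveRelations.not_strictMono (C := ![O, L, B.dualSubmodule L, B.dualSubmodule O])
      (hpres.hasPrimitiveRelations_three.mono hMO hOM) hkill (Fin.strictMono_iff_lt_succ.2 ?_)
    exact Fin.forall_fin_succ.2 ⟨hOL', Fin.forall_fin_two.2 ⟨hLL', hLO'⟩⟩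

end BilinForm

section Trace

variable {R K Q : Type*} [CommRing R] [Field K] [Algebra R K] [CommRing Q] [Algebra K Q]
  [Algebra R Q] [IsScalarTower R K Q]

theorem traceDualSubmodule_eq_dualSubmodule (M : Submodule R Q) :
    traceDualSubmodule R K Q M = (Algebra.traceForm K Q).dualSubmodule M := by
  ext x
  exact forall₂_congr fun y _ => mem_one.symm

variable [IsIntegrallyClosed R] [IsFractionRing R K]

theorem integralClosure_le_traceForm_dualSubmodule [Module.Finite K Q] :
    Subalgebra.toSubmodule (integralClosure R Q) ≤
      (Algebra.traceForm K Q).dualSubmodule (Subalgebra.toSubmodule (integralClosure R Q)) :=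
  fun _ hx _ hy => mem_one.2 <|
    IsIntegrallyClosed.isIntegral_iff.1 (isIntegral_trace_of_finite (IsIntegral.mul hx hy))

end Trace

section Local

variable {R K Q : Type*} [CommRing R] [IsDomain R] [IsDiscreteValuationRing R] [Field K]
  [Algebra R K] [IsFractionRing R K] [CommRing Q] [Algebra K Q] [Algebra R Q] [IsScalarTower R K Q]
  {ϖ : R} {M : Submodule R Q} [IsLattice K M] {e f : Q}

theorem integralClosure_eq_lowerRootLattice_of_isOrthogonalPair (hϖ : Irreducible ϖ)
    (h2 : IsUnit (2 : R)) (hQ : IsFiniteEtaleAlgebra K Q)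
    (hM : M ≤ Subalgebra.toSubmodule (integralClosure R Q)) {i j : ℕ}
    (h : IsOrthogonalPair (Algebra.traceForm K Q) M e f (ϖ ^ i) (ϖ ^ j))
    (hij : i * j = 0 ∨ Odd (i + j)) :
    Subalgebra.toSubmodule (integralClosure R Q) =
      lowerRootLattice (fun k : ℕ => ϖ ^ k) M (traceDualSubmodule R K Q M) := by
  obtain ⟨hfin, hQ⟩ := hQ
  have hsymm := Algebra.traceForm_isSymm K (S := Q)
  have hdual := integralClosure_le_traceForm_dualSubmodule (R := R) (K := K) (Q := Q)
  have hanti := dualSubmodule_anti (B := Algebra.traceForm K Q) hM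
  have := isLattice_of_le_dualSubmodule hQ hM (hdual.trans hanti)
  have hrel := (h.isDiagonalPresentation hsymm hQ).hasPrimitiveRelations_three.mono hM hanti
  rw [traceDualSubmodule_eq_dualSubmodule]
  exact h.eq_lowerRootLattice hsymm hQ hϖ hij hM hdual fun z hz =>
    smul_mem_integralClosure_of_mem_dualSubmodule hϖ h2 hrel hz

theorem integralClosure_eq_lowerRootLattice_of_cyclic (hϖ : Irreducible ϖ) (h2 : IsUnit (2 : R))
    (hQ : IsFiniteEtaleAlgebra K Q) (hM : M ≤ Subalgebra.toSubmodule (integralClosure R Q))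
    (he : e ∈ traceDualSubmodule R K Q M) (hspan : traceDualSubmodule R K Q M ≤ span R {e} ⊔ M) :
    Subalgebra.toSubmodule (integralClosure R Q) =
      lowerRootLattice (fun k : ℕ => ϖ ^ k) M (traceDualSubmodule R K Q M) := by
  rw [traceDualSubmodule_eq_dualSubmodule] at he hspan
  obtain ⟨i, hi⟩ := exists_smul_mem_one_iff_pow_dvd hϖ (Algebra.traceForm K Q e e)
  refine integralClosure_eq_lowerRootLattice_of_isOrthogonalPair hϖ h2 hQ hM (f := 0) (i := i)
    (j := 0) ⟨he, zero_mem _, ?_, map_zero _, hi, fun x => ?_⟩ (.inl (mul_zero i))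
  · rwa [Set.pair_comm, span_insert_zero]
  · simp

theorem integralClosure_eq_lowerRootLattice_of_odd (hϖ : Irreducible ϖ) (h2 : IsUnit (2 : R))
    (hQ : IsFiniteEtaleAlgebra K Q) (hM : M ≤ Subalgebra.toSubmodule (integralClosure R Q))
    (he : e ∈ traceDualSubmodule R K Q M) (hf : f ∈ traceDualSubmodule R K Q M)
    (hspan : traceDualSubmodule R K Q M ≤ span R {e, f} ⊔ M) {l : ℕ} (hl : Odd l)
    (hlength : Module.length R
      (traceDualSubmodule R K Q M ⧸ M.submoduleOf (traceDualSubmodule R K Q M)) = l) :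
    Subalgebra.toSubmodule (integralClosure R Q) =
      lowerRootLattice (fun k : ℕ => ϖ ^ k) M (traceDualSubmodule R K Q M) := by
  rw [traceDualSubmodule_eq_dualSubmodule] at he hf hspan hlength
  have hsymm := Algebra.traceForm_isSymm K (S := Q)
  obtain ⟨e', f', i, j, h⟩ := exists_isOrthogonalPair hsymm hϖ h2 he hf hspan
  rw [(h.isDiagonalPresentation hsymm hQ.2).length_quotient hϖ, Nat.cast_inj] at hlength
  exact integralClosure_eq_lowerRootLattice_of_isOrthogonalPair hϖ h2 hQ hM h (.inr (hlength ▸ hl))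

theorem integralClosure_eq_lowerRootLattice_of_isDiagonalPresentation (hϖ : Irreducible ϖ)
    (h2 : IsUnit (2 : R)) (hQ : IsFiniteEtaleAlgebra K Q)
    (hM : M ≤ Subalgebra.toSubmodule (integralClosure R Q)) {i j : ℕ}
    (h : IsDiagonalPresentation M (traceDualSubmodule R K Q M) e f (ϖ ^ i) (ϖ ^ j))
    (hij : i * j = 0 ∨ Odd (i + j)) :
    Subalgebra.toSubmodule (integralClosure R Q) =
      lowerRootLattice (fun k : ℕ => ϖ ^ k) M (traceDualSubmodule R K Q M) := by
  rcases hij with hij | hij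
  · rcases mul_eq_zero.1 hij with rfl | rfl
    · rw [pow_zero] at h
      exact integralClosure_eq_lowerRootLattice_of_cyclic hϖ h2 hQ hM h.right_mem
        h.symm.le_span_singleton_sup
    · rw [pow_zero] at h
      exact integralClosure_eq_lowerRootLattice_of_cyclic hϖ h2 hQ hM h.left_mem
        h.le_span_singleton_sup
  · exact integralClosure_eq_lowerRootLattice_of_odd hϖ h2 hQ hM h.left_mem h.right_mem
      h.le_span_sup hij (h.length_quotient hϖ)

end Local

end LocalTheorem

section OrderQuotient

open Submodule

theorem le_span_image_sup {R V : Type*} [CommRing R] [AddCommGroup V] [Module R V]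
    {M N : Submodule R V} {t : Set N} (ht : span R (mkQ (M.submoduleOf N) '' t) = ⊤) :
    N ≤ span R (N.subtype '' t) ⊔ M := by
  rw [span_image, map_mkQ_eq_top] at ht
  calc N = map N.subtype (M.submoduleOf N) ⊔ map N.subtype (span R t) := by
        rw [← Submodule.map_sup, ht, map_subtype_top]
    _ ≤ span R (N.subtype '' t) ⊔ M := by
        rw [sup_comm, span_image]
        exact sup_le_sup_left (map_comap_le _ _) _

variable {R A K Q : Type*} [CommRing R] [CommRing A] [Algebra R A] [Field K] [Algebra R K]
  [CommRing Q] [Algebra A Q] [Algebra K Q] [Algebra R Q] [IsScalarTower R A Q]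

theorem orderClosure_eq [Algebra.IsIntegral R A] :
    orderClosure R A Q = Subalgebra.toSubmodule (integralClosure R Q) := by
  ext x
  exact ⟨fun h => isIntegral_trans (R := R) (A := A) x h, fun h => IsIntegral.tower_top h⟩

theorem orderSubmodule_le_orderClosure : orderSubmodule R A Q ≤ orderClosure R A Q := by
  rintro _ ⟨a, rfl⟩
  exact isIntegral_algebraMap

theorem quotientSubmodule_lowerRootLattice {ι : Type*} (c : ι → R)
    (hA : orderSubmodule R A Q ≤ orderDual R A K Q) :
    quotientSubmodule R A K Q (lowerRootLattice c (orderSubmodule R A Q) (orderDual R A K Q)) =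
      ⨆ k, LinearMap.range (LinearMap.lsmul R (DualQuotient R A K Q) (c k)) ⊓
        torsionBy R (DualQuotient R A K Q) (c k) := by
  apply le_antisymm
  · rw [quotientSubmodule, map_le_iff_le_comap, submoduleOf,
      ← map_le_map_iff_of_injective (orderDual R A K Q).injective_subtype, map_comap_subtype,
      inf_eq_right.2 (lowerRootLattice_le hA), lowerRootLattice_le_iff]
    refine ⟨fun a ha => ⟨⟨a, hA ha⟩, ?_, rfl⟩,
      fun k y hy hyA => ⟨c k • ⟨y, hy⟩, mem_iSup_of_mem k ⟨⟨mkQ _ ⟨y, hy⟩, rfl⟩, ?_⟩, rfl⟩⟩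
    · exact LinearMap.ker_le_comap (mkQ _) ((ker_mkQ _).ge ha)
    · exact (Submodule.Quotient.mk_eq_zero _).2 hyA
  · refine iSup_le fun k => ?_
    rintro _ ⟨⟨z, rfl⟩, hz⟩
    obtain ⟨⟨y, hy⟩, rfl⟩ := mkQ_surjective _ z
    have hyA : c k • c k • (⟨y, hy⟩ : orderDual R A K Q) ∈
        (orderSubmodule R A Q).submoduleOf (orderDual R A K Q) :=
      (Submodule.Quotient.mk_eq_zero _).1 hz
    exact ⟨c k • ⟨y, hy⟩, smul_mem_lowerRootLattice (y := y) hy hyA, rfl⟩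

variable [IsScalarTower R K Q]

theorem orderClosure_le_orderDual [IsIntegrallyClosed R] [IsFractionRing R K] [Module.Finite K Q]
    [Algebra.IsIntegral R A] : orderClosure R A Q ≤ orderDual R A K Q := by
  have hA := orderSubmodule_le_orderClosure (R := R) (A := A) (Q := Q)
  rw [orderClosure_eq] at hA ⊢
  rw [orderDual, traceDualSubmodule_eq_dualSubmodule]
  exact integralClosure_le_traceForm_dualSubmodule.trans (dualSubmodule_anti hA)

theorem closureQuotientEq_of_integralClosure_eq [IsIntegrallyClosed R] [IsFractionRing R K]
    [Module.Finite K Q] [Algebra.IsIntegral R A] {ι : Type*} (c : ι → R)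
    (h : Subalgebra.toSubmodule (integralClosure R Q) =
      lowerRootLattice c (orderSubmodule R A Q) (orderDual R A K Q)) :
    ClosureQuotientEq R A K Q
      (⨆ k, LinearMap.range (LinearMap.lsmul R (DualQuotient R A K Q) (c k)) ⊓
        torsionBy R (DualQuotient R A K Q) (c k)) := by
  refine ⟨orderSubmodule_le_orderClosure, orderClosure_le_orderDual, ?_⟩
  rw [orderClosure_eq, h, quotientSubmodule_lowerRootLattice c
    (orderSubmodule_le_orderClosure.trans orderClosure_le_orderDual)]

theorem isLattice_orderSubmodule [IsDomain R] [IsFractionRing R K] [IsFractionRing A Q]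
    [Module.Finite R A] : IsLattice K (orderSubmodule R A Q) := by
  refine ⟨?_, eq_top_iff.2 fun x _ => ?_⟩
  · rw [orderSubmodule, ← Submodule.map_top]
    exact Module.Finite.fg_top.map _
  · obtain ⟨a, b, rfl⟩ := IsLocalization.exists_mk'_eq (nonZeroDivisors A) x
    obtain ⟨d, r, hr, h⟩ := (Algebra.IsIntegral.isIntegral (R := R)
      (b : A)).isAlgebraic.exists_smul_eq_mul a b.2
    have hrK : algebraMap R K r ≠ 0 := by simpa using hr
    have hmk : IsLocalization.mk' Q a b = (algebraMap R K r)⁻¹ • algebraMap A Q d := by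
      rw [eq_inv_smul_iff₀ hrK, algebraMap_smul, ← algebraMap_smul A r, IsLocalization.smul_mk',
        ← Algebra.smul_def, h, IsLocalization.mk'_mul_cancel_left]
    rw [hmk]
    exact smul_mem _ _ (subset_span ⟨d, rfl⟩)

theorem lowerRoot_eq {M : Type*} [IsDomain R] [IsDiscreteValuationRing R] [AddCommGroup M]
    [Module R M] {ϖ : R} (hϖ : Irreducible ϖ) :
    lowerRoot R M = ⨆ k : ℕ, LinearMap.range (LinearMap.lsmul R M (ϖ ^ k)) ⊓
      torsionBy R M (ϖ ^ k) := by
  rw [lowerRoot]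
  congr! 3 with k
  · rw [hϖ.maximalIdeal_eq, Ideal.span_singleton_pow, ideal_span_singleton_smul]
    ext x
    simp [mem_smul_pointwise_iff_exists]
  · rw [hϖ.maximalIdeal_eq, Ideal.span_singleton_pow, torsionBySet_span_singleton_eq]

theorem isUnit_two_of_ringChar_ne [IsLocalRing R]
    (h : ringChar (IsLocalRing.ResidueField R) ≠ 2) : IsUnit (2 : R) := by
  have h2 := Ring.two_ne_zero h
  rwa [← map_ofNat (IsLocalRing.residue R), ne_eq, IsLocalRing.residue_eq_zero_iff,
    IsLocalRing.notMem_maximalIdeal] at h2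

theorem closureQuotientEq_lowerRoot [IsDomain R] [IsDiscreteValuationRing R] [IsFractionRing R K]
    [IsFractionRing A Q] (h : IsOrderOver R A K Q)
    (hchar : ringChar (IsLocalRing.ResidueField R) ≠ 2)
    (hgen : (∃ x : DualQuotient R A K Q, span R {x} = ⊤) ∨
      ((∃ x y : DualQuotient R A K Q, span R {x, y} = ⊤) ∧
        ∃ l : ℕ, Odd l ∧ Module.length R (DualQuotient R A K Q) = l)) :
    ClosureQuotientEq R A K Q (lowerRoot R (DualQuotient R A K Q)) := by
  obtain ⟨ϖ, hϖ⟩ := IsDiscreteValuationRing.exists_irreducible R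
  have := h.finite
  have := h.etale.1
  have : IsLattice K (orderSubmodule R A Q) := isLattice_orderSubmodule
  have h2 := isUnit_two_of_ringChar_ne hchar
  have hA := orderSubmodule_le_orderClosure (R := R) (A := A) (Q := Q)
  rw [orderClosure_eq] at hA
  rw [lowerRoot_eq hϖ]
  refine closureQuotientEq_of_integralClosure_eq _ ?_
  rcases hgen with ⟨x, hx⟩ | ⟨⟨x, y, hxy⟩, l, hl, hlength⟩
  · obtain ⟨e, rfl⟩ := mkQ_surjective _ x
    rw [← Set.image_singleton] at hx
    have hspan := le_span_image_sup hx
    rw [Set.image_singleton] at hspan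
    exact integralClosure_eq_lowerRootLattice_of_cyclic hϖ h2 h.etale hA e.2 hspan
  · obtain ⟨e, rfl⟩ := mkQ_surjective _ x
    obtain ⟨f, rfl⟩ := mkQ_surjective _ y
    rw [← Set.image_pair] at hxy
    have hspan := le_span_image_sup hxy
    rw [Set.image_pair] at hspan
    exact integralClosure_eq_lowerRootLattice_of_odd hϖ h2 h.etale hA e.2 f.2 hspan hl hlength

end OrderQuotient

section Localization

open Submodule

section Module

variable {Z R V : Type*} [CommRing Z] [CommRing R] [Algebra Z R] [AddCommGroup V] [Module Z V]
  [Module R V] [IsScalarTower Z R V] {M N : Submodule Z V}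

theorem mem_span_coe_iff (W : Submonoid Z) [IsLocalization W R] {x : V} :
    x ∈ span R (M : Set V) ↔ ∃ s ∈ W, s • x ∈ M := by
  rw [IsLocalization.mem_span_iff W, span_eq]
  constructor
  · rintro ⟨y, hy, s, rfl⟩
    refine ⟨s, s.2, ?_⟩
    rwa [← algebraMap_smul R (s : Z), smul_smul, IsLocalization.mk'_spec', map_one, one_smul]
  · rintro ⟨s, hs, hx⟩
    refine ⟨s • x, hx, ⟨s, hs⟩, ?_⟩
    rw [← algebraMap_smul R s, smul_smul, IsLocalization.mk'_spec_mk, map_one, one_smul]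

theorem algebraMap_dvd_of_mul_eq {W : Submonoid Z} [IsLocalization W R] {x : R} {a x' : Z}
    {d t : W} (hx : x * algebraMap Z R d = algebraMap Z R x') (ha : a ∣ t * x') :
    algebraMap Z R a ∣ x := by
  have hunit := (IsLocalization.map_units R t).mul (IsLocalization.map_units R d)
  rw [← hunit.dvd_mul_left, mul_assoc, mul_comm _ x, hx, ← map_mul]
  exact map_dvd _ ha

theorem IsDiagonalPresentation.span_coe (W : Submonoid Z) [IsLocalization W R] {e f : V}
    {a b : Z} (h : IsDiagonalPresentation M N e f a b) :
    IsDiagonalPresentation (span R (M : Set V)) (span R (N : Set V)) e f (algebraMap Z R a)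
      (algebraMap Z R b) where
  left_mem := subset_span h.left_mem
  right_mem := subset_span h.right_mem
  le_span_sup := span_le.2 fun x hx => by
    obtain ⟨y, hy, z, hz, rfl⟩ := mem_sup.1 (h.le_span_sup hx)
    exact add_mem (mem_sup_left (span_le_restrictScalars Z R _ hy))
      (mem_sup_right (subset_span hz))
  smul_add_smul_mem_iff x y := by
    constructor
    · intro hxy
      obtain ⟨t, ht, hM⟩ := (mem_span_coe_iff W).1 hxy
      obtain ⟨x', y', d, hx, hy⟩ := IsLocalization.surj₂ W R x y
      have hdM : (t * x') • e + (t * y') • f ∈ M := by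
        have := M.smul_mem d hM
        rwa [smul_comm, ← algebraMap_smul R (d : Z), smul_add, smul_smul, smul_smul, mul_comm, hx,
          mul_comm, hy, algebraMap_smul, algebraMap_smul, smul_add, smul_smul, smul_smul] at this
      exact ((h.smul_add_smul_mem_iff _ _).1 hdM).imp (algebraMap_dvd_of_mul_eq (t := ⟨t, ht⟩) hx)
        (algebraMap_dvd_of_mul_eq (t := ⟨t, ht⟩) hy)
    · have hab : ∀ r s : Z, (a * r) • e + (b * s) • f ∈ M := fun r s =>
        (h.smul_add_smul_mem_iff _ _).2 ⟨dvd_mul_right a r, dvd_mul_right b s⟩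
      have ha : a • e ∈ M := by simpa using hab 1 0
      have hb : b • f ∈ M := by simpa using hab 0 1
      rintro ⟨⟨x', rfl⟩, ⟨y', rfl⟩⟩
      rw [mul_comm, mul_smul, mul_comm, mul_smul, algebraMap_smul, algebraMap_smul]
      exact add_mem (smul_mem _ _ (subset_span ha)) (smul_mem _ _ (subset_span hb))

end Module

section DualSubmodule

variable {Z R K V : Type*} [CommRing Z] [CommRing R] [Algebra Z R] [Field K] [Algebra Z K]
  [Algebra R K] [AddCommGroup V] [Module K V] [Module Z V] [Module R V]
  [IsScalarTower Z R V] [IsScalarTower Z K V] [IsScalarTower R K V]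
  {B : LinearMap.BilinForm K V} {M : Submodule Z V}

theorem isLattice_span_coe [IsLattice K M] : IsLattice K (span R (M : Set V)) where
  fg := by
    obtain ⟨S, hS⟩ := IsLattice.fg (A := K) (M := M)
    rw [← hS, span_span_of_tower]
    exact fg_span S.finite_toSet
  span_eq_top := by
    rw [span_span_of_tower, IsLattice.span_eq_top]

theorem span_dualSubmodule [IsScalarTower Z R K] (W : Submonoid Z) [IsLocalization W R]
    (hM : M.FG) :
    span R (B.dualSubmodule M : Set V) = B.dualSubmodule (span R (M : Set V)) := by
  have hone (z : K) : z ∈ (1 : Submodule R K) ↔ ∃ s ∈ W, s • z ∈ (1 : Submodule Z K) := by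
    rw [← mem_span_coe_iff (R := R), one_eq_span (R := Z), span_span_of_tower, ← one_eq_span]
  apply le_antisymm
  · refine span_le.2 fun x hx y hy => (hone _).2 ?_
    obtain ⟨s, hs, hsy⟩ := (mem_span_coe_iff W).1 hy
    exact ⟨s, hs, by simpa only [B.smul_right_of_tower] using hx _ hsy⟩
  · obtain ⟨S, rfl⟩ := hM
    intro x hx
    have hxS : ∀ y : S, ∃ r, algebraMap R K r = B x y := fun y =>
      mem_one.1 (hx y (subset_span (subset_span y.2)))
    choose r hr using hxS
    obtain ⟨s, hs⟩ := IsLocalization.exist_integer_multiples_of_finite W r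
    refine (mem_span_coe_iff W).2 ⟨s, s.2, fun y hy => ?_⟩
    refine (span_le (p := (1 : Submodule Z K).comap ((B ((s : Z) • x)).restrictScalars Z))).2
      (fun z hz => ?_) hy
    obtain ⟨c, hc⟩ := hs ⟨z, hz⟩
    have hcz : algebraMap Z K c = (s : Z) • B x z := by
      rw [IsScalarTower.algebraMap_apply Z R K, hc, ← algebraMap_smul R (s : Z), smul_eq_mul,
        map_mul, hr, ← Algebra.smul_def, algebraMap_smul]
    exact mem_one.2 ⟨c, hcz.trans (B.smul_left_of_tower _ _ _).symm⟩

end DualSubmodule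

section LowerRootLattice

variable {Z R V : Type*} [CommRing Z] [WfDvdMonoid Z] [CommRing R] [Algebra Z R]
  [AddCommGroup V] [Module Z V] [Module R V] [IsScalarTower Z R V] {M D : Submodule Z V}
  {W : Submonoid Z} [IsLocalization W R] {p : Z}

theorem span_lowerRootLattice_id (hp : Irreducible p) (hW : ∀ s, s ∈ W ↔ ¬ p ∣ s) :
    span R (lowerRootLattice (id : Z → Z) M D : Set V) =
      lowerRootLattice (fun k : ℕ => algebraMap Z R p ^ k) (span R (M : Set V))
        (span R (D : Set V)) := by
  have hpow : ∀ (k : ℕ) (x : V), algebraMap Z R p ^ k • x = p ^ k • x := fun k x => by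
    rw [← map_pow, algebraMap_smul]
  apply le_antisymm
  · suffices lowerRootLattice (id : Z → Z) M D ≤ restrictScalars Z
        (lowerRootLattice (fun k : ℕ => algebraMap Z R p ^ k) (span R (M : Set V))
          (span R (D : Set V))) from span_le.2 this
    refine lowerRootLattice_le_iff.2
      ⟨fun x hx => le_lowerRootLattice (subset_span hx), fun r y hy hyM => ?_⟩
    rw [id] at hyM ⊢
    rcases eq_or_ne r 0 with rfl | hr
    · rw [zero_smul]
      exact zero_mem _
    obtain ⟨k, c, hc, rfl⟩ := WfDvdMonoid.max_power_factor hr hp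
    rw [mul_smul, mul_smul] at hyM
    rw [mul_smul, ← hpow]
    refine smul_mem_lowerRootLattice (subset_span (D.smul_mem c hy)) ?_
    refine (mem_span_coe_iff W).2 ⟨c, (hW c).2 hc, ?_⟩
    rwa [hpow, hpow, smul_comm c]
  · refine lowerRootLattice_le_iff.2 ⟨span_mono le_lowerRootLattice, fun k y hy hyM => ?_⟩
    rw [hpow] at hyM ⊢
    rw [hpow] at hyM
    obtain ⟨s, hs, hy⟩ := (mem_span_coe_iff W).1 hy
    obtain ⟨t, ht, hyM⟩ := (mem_span_coe_iff W).1 hyM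
    refine (mem_span_coe_iff W).2 ⟨s * t, W.mul_mem hs ht, ?_⟩
    rw [smul_comm]
    refine smul_mem_lowerRootLattice (c := id) ?_ ?_
    · rw [mul_comm, mul_smul]
      exact D.smul_mem t hy
    · rw [id, smul_comm _ (s * t), smul_comm _ (s * t), mul_smul]
      exact M.smul_mem s hyM

end LowerRootLattice

section IntegralClosure

variable {Z R Q : Type*} [CommRing Z] [CommRing R] [Algebra Z R] [CommRing Q] [Algebra Z Q]
  [Algebra R Q] [IsScalarTower Z R Q]

theorem span_integralClosure (W : Submonoid Z) [IsLocalization W R] :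
    span R (Subalgebra.toSubmodule (integralClosure Z Q) : Set Q) =
      Subalgebra.toSubmodule (integralClosure R Q) := by
  refine le_antisymm (span_le.2 fun x hx => IsIntegral.tower_top hx) fun x hx => ?_
  obtain ⟨s, hs⟩ := IsIntegral.exists_multiple_integral_of_isLocalization W x hx
  exact (mem_span_coe_iff W).2 ⟨s, s.2, hs⟩

end IntegralClosure

end Localization

section LocalGlobal

open Submodule

theorem associated_algebraMap_pow_multiplicity {Z R : Type*} [CommRing Z] [IsDomain Z]
    [WfDvdMonoid Z] [CommRing R] [Algebra Z R] {W : Submonoid Z} [IsLocalization W R] {p : Z}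
    (hp : Prime p) (hW : ∀ s, s ∈ W ↔ ¬ p ∣ s) {m : Z} (hm : m ≠ 0) :
    Associated (algebraMap Z R m) (algebraMap Z R p ^ multiplicity p m) := by
  obtain ⟨c, hc, hpc⟩ :=
    (FiniteMultiplicity.of_not_isUnit hp.not_isUnit hm).exists_eq_pow_mul_and_not_dvd
  have hunit : IsUnit (algebraMap Z R c) := IsLocalization.map_units R (⟨c, (hW c).2 hpc⟩ : W)
  rw [← map_pow]
  conv_lhs => rw [hc, map_mul]
  exact associated_mul_unit_left _ _ hunit

theorem span_integralClosure_eq_span_lowerRootLattice {Z R K Q : Type*} [CommRing Z] [IsDomain Z]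
    [WfDvdMonoid Z] [CommRing R] [IsDomain R] [IsDiscreteValuationRing R]
    [Algebra Z R] [Field K] [Algebra Z K] [Algebra R K] [IsFractionRing R K]
    [IsScalarTower Z R K] [CommRing Q] [Algebra K Q] [Algebra R Q] [Algebra Z Q]
    [IsScalarTower Z K Q] [IsScalarTower R K Q] [IsScalarTower Z R Q] {M : Submodule Z Q}
    [IsLattice K M] {p : Z} (W : Submonoid Z) [IsLocalization W R]
    (hϖ : Irreducible (algebraMap Z R p)) (hp : Prime p) (hW : ∀ s, s ∈ W ↔ ¬ p ∣ s)
    (h2 : ¬ p ∣ 2) (hQ : IsFiniteEtaleAlgebra K Q)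
    (hM : M ≤ Subalgebra.toSubmodule (integralClosure Z Q)) {e f : Q} {m m' : Z} (hm : m ≠ 0)
    (hm' : m' ≠ 0)
    (h : IsDiagonalPresentation M (traceDualSubmodule Z K Q M) e f m m')
    (hpar : multiplicity p m * multiplicity p m' = 0 ∨
      Odd (multiplicity p m + multiplicity p m')) :
    span R (Subalgebra.toSubmodule (integralClosure Z Q) : Set Q) =
      span R (lowerRootLattice (id : Z → Z) M (traceDualSubmodule Z K Q M) : Set Q) := by
  have h2R : IsUnit (2 : R) := by
    simpa only [map_ofNat] using IsLocalization.map_units R (⟨2, (hW 2).2 h2⟩ : W)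
  have hdual : span R (traceDualSubmodule Z K Q M : Set Q) =
      traceDualSubmodule R K Q (span R (M : Set Q)) := by
    rw [traceDualSubmodule_eq_dualSubmodule, traceDualSubmodule_eq_dualSubmodule,
      span_dualSubmodule W (IsLattice.fg (A := K))]
  have := isLattice_span_coe (R := R) (K := K) (M := M)
  have hpres := (h.span_coe (R := R) W).of_associated
    (associated_algebraMap_pow_multiplicity hp hW hm)
    (associated_algebraMap_pow_multiplicity hp hW hm')
  rw [span_lowerRootLattice_id hp.irreducible hW, span_integralClosure W, hdual]
  rw [hdual] at hpres
  refine integralClosure_eq_lowerRootLattice_of_isDiagonalPresentation hϖ h2R hQ ?_ hpres hpar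
  rw [← span_integralClosure W]
  exact span_mono hM

theorem mem_of_forall_prime_exists_smul_mem {Z V : Type*} [CommRing Z] [IsPrincipalIdealRing Z]
    [AddCommGroup V] [Module Z V] {M : Submodule Z V} {n : Z} (hn : n ≠ 0) {x : V}
    (hnx : n • x ∈ M) (h : ∀ p, Prime p → p ∣ n → ∃ s, ¬ p ∣ s ∧ s • x ∈ M) : x ∈ M := by
  let I : Ideal Z := M.comap (LinearMap.toSpanSingleton Z V x)
  by_contra hx
  have hI : I ≠ ⊤ := fun hI => hx <| by
    simpa [I] using (Ideal.eq_top_iff_one I).1 hI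
  obtain ⟨P, hP, hIP⟩ := Ideal.exists_le_maximal I hI
  obtain ⟨p, rfl⟩ := IsPrincipalIdealRing.principal P
  have hdvd : ∀ s : Z, s • x ∈ M → p ∣ s := fun s hs => Ideal.mem_span_singleton.1 (hIP hs)
  have hp : p ≠ 0 := fun hp => hn (zero_dvd_iff.1 (hp ▸ hdvd n hnx))
  obtain ⟨s, hs, hsx⟩ := h p ((Ideal.span_singleton_prime hp).1 hP.isPrime) (hdvd n hnx)
  exact hs (hdvd s hsx)

theorem IsDiagonalPresentation.mul_smul_mem {R V : Type*} [CommRing R] [AddCommGroup V] [Module R V]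
    {M N : Submodule R V} {e f : V} {a b : R} (h : IsDiagonalPresentation M N e f a b) {x : V}
    (hx : x ∈ N) : (a * b) • x ∈ M := by
  obtain ⟨r, s, z, hz, rfl⟩ := exists_smul_add_smul_add_eq h.le_span_sup hx
  rw [smul_add, smul_add, smul_smul, smul_smul]
  exact add_mem ((h.smul_add_smul_mem_iff _ _).2
    ⟨(dvd_mul_right a b).mul_right r, (dvd_mul_left b a).mul_right s⟩) (smul_mem _ _ hz)

section PrincipalIdealRing

variable {Z K Q : Type*} [CommRing Z] [IsDomain Z] [IsPrincipalIdealRing Z] [Field K]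
  [Algebra Z K] [IsFractionRing Z K] [CommRing Q] [Algebra K Q] [Algebra Z Q]
  [IsScalarTower Z K Q] {M : Submodule Z Q} [IsLattice K M] {e f : Q} {m m' : Z}

theorem exists_smul_mem_integralClosure_iff {p : Z} (hp : Prime p) (h2 : ¬ p ∣ 2)
    (hQ : IsFiniteEtaleAlgebra K Q) (hM : M ≤ Subalgebra.toSubmodule (integralClosure Z Q))
    (hm : m ≠ 0) (hm' : m' ≠ 0)
    (h : IsDiagonalPresentation M (traceDualSubmodule Z K Q M) e f m m')
    (hpar : multiplicity p m * multiplicity p m' = 0 ∨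
      Odd (multiplicity p m + multiplicity p m')) (x : Q) :
    (∃ s, ¬ p ∣ s ∧ s • x ∈ Subalgebra.toSubmodule (integralClosure Z Q)) ↔
      ∃ s, ¬ p ∣ s ∧ s • x ∈ lowerRootLattice (id : Z → Z) M (traceDualSubmodule Z K Q M) := by
  have hprime : (Ideal.span {p}).IsPrime := (Ideal.span_singleton_prime hp.ne_zero).2 hp
  have hbot : Ideal.span {p} ≠ ⊥ := by simpa using hp.ne_zero
  let W := (Ideal.span {p}).primeCompl
  have hW : ∀ s, s ∈ W ↔ ¬ p ∣ s := fun s => not_congr Ideal.mem_span_singleton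
  let R := Localization.subalgebra.ofField K W (Ideal.primeCompl_le_nonZeroDivisors _)
  have : IsLocalization.AtPrime R (Ideal.span {p}) :=
    Localization.subalgebra.isLocalization_ofField K W _
  have : IsDiscreteValuationRing R :=
    IsLocalization.AtPrime.isDiscreteValuationRing_of_dedekind_domain Z hbot R
  have hϖ : Irreducible (algebraMap Z R p) := by
    rw [IsDiscreteValuationRing.irreducible_iff_uniformizer,
      ← IsLocalization.AtPrime.map_eq_maximalIdeal (Ideal.span {p}) R, Ideal.map_span,
      Set.image_singleton]
  simp only [← hW]
  rw [← mem_span_coe_iff (R := R), ← mem_span_coe_iff (R := R),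
    span_integralClosure_eq_span_lowerRootLattice W hϖ hp hW h2 hQ hM hm hm' h hpar]

theorem integralClosure_eq_lowerRootLattice (hQ : IsFiniteEtaleAlgebra K Q)
    (hM : M ≤ Subalgebra.toSubmodule (integralClosure Z Q)) (hm : m ≠ 0) (hm' : m' ≠ 0)
    (h : IsDiagonalPresentation M (traceDualSubmodule Z K Q M) e f m m')
    (hpar : ∀ p : Z, Prime p → p ∣ m * m' → ¬ p ∣ 2 ∧
      (multiplicity p m * multiplicity p m' = 0 ∨ Odd (multiplicity p m + multiplicity p m'))) :
    Subalgebra.toSubmodule (integralClosure Z Q) =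
      lowerRootLattice (id : Z → Z) M (traceDualSubmodule Z K Q M) := by
  have hfin := hQ.1
  have hOD : Subalgebra.toSubmodule (integralClosure Z Q) ≤ traceDualSubmodule Z K Q M := by
    rw [traceDualSubmodule_eq_dualSubmodule]
    exact integralClosure_le_traceForm_dualSubmodule.trans (dualSubmodule_anti hM)
  have hiff : ∀ p, Prime p → p ∣ m * m' → ∀ x : Q, _ := fun p hp hdvd =>
    exists_smul_mem_integralClosure_iff hp (hpar p hp hdvd).1 hQ hM hm hm' h (hpar p hp hdvd).2
  have hmm' := mul_ne_zero hm hm'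
  have hself : ∀ (N : Submodule Z Q), ∀ p : Z, Prime p → ∀ x ∈ N, ∃ s, ¬ p ∣ s ∧ s • x ∈ N :=
    fun N p hp x hx => ⟨1, hp.not_dvd_one, by rwa [one_smul]⟩
  apply le_antisymm <;> refine fun x hx => mem_of_forall_prime_exists_smul_mem hmm' ?_
    fun p hp hdvd => ?_
  · exact le_lowerRootLattice (h.mul_smul_mem (hOD hx))
  · exact (hiff p hp hdvd x).1 (hself _ p hp x hx)
  · exact hM (h.mul_smul_mem (lowerRootLattice_le (hM.trans hOD) hx))
  · exact (hiff p hp hdvd x).2 (hself _ p hp x hx)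

end PrincipalIdealRing

end LocalGlobal

section Integers

open Submodule

theorem multiplicity_int_natCast {p : ℤ} (hp : Prime p) {n : ℕ} (hn : n ≠ 0) :
    multiplicity p (n : ℤ) = n.factorization p.natAbs := by
  rw [multiplicity_eq_of_emultiplicity_eq
    (emultiplicity_eq_of_associated_left p.associated_natAbs.symm), Int.natCast_multiplicity,
    Nat.multiplicity_eq_factorization (Int.prime_iff_natAbs_prime.1 hp) hn]

theorem nonempty_intLinearEquiv_of_addEquiv_zmod {B : Type*} [AddCommGroup B] [Module ℤ B]
    {m m' : ℕ} (ψ : B ≃+ ZMod m × ZMod m') :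
    Nonempty (B ≃ₗ[ℤ] (ℤ ⧸ Ideal.span {(m : ℤ)}) × (ℤ ⧸ Ideal.span {(m' : ℤ)})) := by
  let ψ' := ψ.trans ((Int.quotientSpanNatEquivZMod m).symm.toAddEquiv.prodCongr
    (Int.quotientSpanNatEquivZMod m').symm.toAddEquiv)
  exact ⟨ψ'.toLinearEquiv fun r x => map_intCast_smul ψ' ℤ ℤ r x⟩

theorem not_dvd_two_of_dvd_of_odd {p n : ℤ} (hp : ¬ IsUnit p) (hn : Odd n) (h : p ∣ n) :
    ¬ p ∣ 2 := by
  intro h2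
  obtain ⟨k, rfl⟩ := hn
  exact hp (isUnit_of_dvd_one ((dvd_add_right (h2.mul_right k)).1 h))

theorem isFractionRing_adjoin {R K L : Type*} [CommRing R] [Field K] [Algebra R K]
    [IsFractionRing R K] [Field L] [Algebra K L] [Algebra R L] [IsScalarTower R K L] {S : Set L}
    (hS : IntermediateField.adjoin K S = ⊤) : IsFractionRing (Algebra.adjoin R S) L := by
  have := (FaithfulSMul.algebraMap_injective K L).comp (IsFractionRing.injective R K)
  refine .of_field _ _ fun z => ?_
  obtain ⟨a, ha, b, hb, rfl⟩ :=
    IntermediateField.mem_adjoin_iff_div.1 (hS.ge (IntermediateField.mem_top (x := z)))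
  obtain ⟨s, hs⟩ := multiple_mem_adjoin_of_mem_localization_adjoin (nonZeroDivisors R) K S a ha
  obtain ⟨t, ht⟩ := multiple_mem_adjoin_of_mem_localization_adjoin (nonZeroDivisors R) K S b hb
  have hunit (u : nonZeroDivisors R) : algebraMap R L u ≠ 0 := by
    rw [IsScalarTower.algebraMap_apply R K L, map_ne_zero]
    exact (IsLocalization.map_units K u).ne_zero
  refine ⟨⟨_, Subalgebra.smul_mem _ hs t⟩, ⟨_, Subalgebra.smul_mem _ ht s⟩, ?_⟩
  change a / b = (t • s • a) / (s • t • b)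
  simp only [Submonoid.smul_def, Algebra.smul_def]
  have := hunit s
  have := hunit t
  field_simp

theorem closureQuotientEq_lowerRootInt {A Q : Type*} [CommRing A] [CommRing Q] [Algebra A Q]
    [IsFractionRing A Q] [Algebra ℚ Q] (h : IsOrderOver ℤ A ℚ Q)
    (hB : IsOddAlternating (DualQuotient ℤ A ℚ Q)) :
    ClosureQuotientEq ℤ A ℚ Q (lowerRootInt (DualQuotient ℤ A ℚ Q)) := by
  have := h.finite
  have := h.etale.1
  have : IsLattice ℚ (orderSubmodule ℤ A Q) := isLattice_orderSubmodule
  have hA := orderSubmodule_le_orderClosure (R := ℤ) (A := A) (Q := Q)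
  rw [orderClosure_eq] at hA
  obtain ⟨hodd, m, m', hm, hm', ⟨ψ⟩, hpar⟩ := hB
  rw [Nat.card_congr ψ.toEquiv, Nat.card_prod, Nat.card_zmod, Nat.card_zmod] at hodd
  obtain ⟨φ⟩ := nonempty_intLinearEquiv_of_addEquiv_zmod ψ
  obtain ⟨e, f, hef⟩ := exists_isDiagonalPresentation_of_linearEquiv φ
  refine closureQuotientEq_of_integralClosure_eq id (integralClosure_eq_lowerRootLattice h.etale hA
    (Nat.cast_ne_zero.2 hm.ne') (Nat.cast_ne_zero.2 hm'.ne') hef fun p hp hdvd => ⟨?_, ?_⟩)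
  · exact not_dvd_two_of_dvd_of_odd hp.not_isUnit (by exact_mod_cast hodd) hdvd
  · rw [multiplicity_int_natCast hp hm.ne', multiplicity_int_natCast hp hm'.ne']
    exact hpar _ (Int.prime_iff_natAbs_prime.1 hp)

theorem closureQuotientEq_adjoin {K : Type*} [Field K] [NumberField K] {α : K}
    (hα : IsIntegral ℤ α) (hK : IntermediateField.adjoin ℚ {α} = ⊤)
    (hB : IsOddAlternating (DualQuotient ℤ (Algebra.adjoin ℤ {α}) ℚ K)) :
    ClosureQuotientEq ℤ (Algebra.adjoin ℤ {α}) ℚ K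
      (lowerRootInt (DualQuotient ℤ (Algebra.adjoin ℤ {α}) ℚ K)) := by
  have := isFractionRing_adjoin (R := ℤ) hK
  have hfin : Module.Finite ℤ (Algebra.adjoin ℤ {α}) :=
    Module.Finite.iff_fg.2 hα.fg_adjoin_singleton
  exact closureQuotientEq_lowerRootInt
    ⟨hfin, inferInstance, inferInstance, traceForm_nondegenerate ℚ K⟩ hB

end Integers

theorem mainTheorem6 :
    -- the local result, over a discrete valuation ring
    (∀ (R A K Q : Type*) [CommRing R] [IsDomain R] [IsDiscreteValuationRing R]
        [CommRing A] [Algebra R A] [Field K] [Algebra R K] [IsFractionRing R K]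
        [CommRing Q] [Algebra A Q] [IsFractionRing A Q] [Algebra K Q] [Algebra R Q]
        [IsScalarTower R A Q] [IsScalarTower R K Q],
      IsOrderOver R A K Q →
      ringChar (IsLocalRing.ResidueField R) ≠ 2 →
      ((∃ x : DualQuotient R A K Q, Submodule.span R {x} = ⊤) ∨
        ((∃ x y : DualQuotient R A K Q, Submodule.span R {x, y} = ⊤) ∧
          ∃ l : ℕ, Odd l ∧ Module.length R (DualQuotient R A K Q) = l)) →
      ClosureQuotientEq R A K Q (lowerRoot R (DualQuotient R A K Q))) ∧
    -- the global result, for orders over the integers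
    (∀ (A Q : Type*) [CommRing A] [CommRing Q] [Algebra A Q] [IsFractionRing A Q] [Algebra ℚ Q],
      IsOrderOver ℤ A ℚ Q →
      IsOddAlternating (DualQuotient ℤ A ℚ Q) →
      ClosureQuotientEq ℤ A ℚ Q (lowerRootInt (DualQuotient ℤ A ℚ Q))) ∧
    -- the case of the order generated by one algebraic integer
    (∀ (K : Type*) [Field K] [NumberField K] (α : K),
      IsIntegral ℤ α → IntermediateField.adjoin ℚ {α} = ⊤ →
      IsOddAlternating (DualQuotient ℤ (Algebra.adjoin ℤ {α}) ℚ K) →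
      ClosureQuotientEq ℤ (Algebra.adjoin ℤ {α}) ℚ K
        (lowerRootInt (DualQuotient ℤ (Algebra.adjoin ℤ {α}) ℚ K))) := by
  refine ⟨?_, ?_, ?_⟩
  · intro R A K Q _ _ _ _ _ _ _ _ _ _ _ _ _ _ _ h hchar hgen
    exact closureQuotientEq_lowerRoot h hchar hgen
  · intro A Q _ _ _ _ _ h hB
    exact closureQuotientEq_lowerRootInt h hB
  · intro K _ _ α hα hK hB
    exact closureQuotientEq_adjoin hα hK hB
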